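/- All digraphs are finite and may have loops and parallel arcs; $\deg_G(u,v)$ is the number of arcs from $u$ to $v$, and $\deg^+_G(v)$ is the out-degree of $v$, loops included. A digraph $G=(V,A)$ is Eulerian if it is connected and every vertex has equal in-degree and out-degree, and it is undirected if $\deg_G(u,v)=\deg_G(v,u)$ for all $u,v\in V$. For an arc $e$ with tail $e^-$ and head $e^+$, an arc $e'$ is a reverse of $e$ if its tail is $e^+$ and its head is $e^-$; $e$ is a bridge if $G\setminus e$ is not strongly connected; $G/e$ is obtained by removing $e$ and merging its two endpoints into one new vertex (the other arcs are kept, possibly becoming loops). Chip-firing game on $G$ with sink $s\in V$: a configuration is a map $c:V\setminus\{s\}\to\mathbb N$. A vertex $v\ne s$ is firable in $c$ if $c(v)\ge\deg^+_G(v)$ and $\deg^+_G(v)>\deg_G(v,v)$; firing it decreases $c(v)$ by $\deg^+_G(v)$ and then increases each $c(u)$, $u\neq s$, by $\deg_G(v,u)$. A configuration without firable vertices is stable; $c^\circ$ denotes the stable configuration reached from $c$ by firings. A stable configuration $c$ is recurrent if for every configuration $d$ there is a configuration $d'$ with $c=(d+d')^\circ$. Let $\mathrm{sum}_{G,s}(c)=\deg_G^+(s)+\sum_{v\ne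 s}c(v)$, let $\kappa(G)$ be the minimum of $\mathrm{sum}_{\overline G,s}(c)$ over all recurrent configurations $c$, with sink $s$, of the digraph $\overline G$ obtained from $G$ by deleting all loops, and let $$\mathcal T_G(y)=\sum_{c}y^{\,\mathrm{sum}_{G,s}(c)-\kappa(G)},$$ the sum being over all recurrent configurations $c$ of $G$ with sink $s$. For Eulerian $G$, $\kappa(G)$ and $\mathcal T_G(y)$ do not depend on the choice of the sink $s$; in the formulas below the sink of each digraph may be chosen arbitrarily and independently. Proposition 8 (neither loop nor bridge recursion). Let $G$ be an Eulerian digraph, possibly with loops, let $e$ be an arc of $G$ that is neither a loop nor a bridge and that has a reverse arc $e'$, and let $H=G/e$. Then, as Laurent polynomials in $y$, $$\mathcal T_G(y)=y^{1+\kappa(G\setminus\{e,e'\})-\kappa(G)}\,\mathcal T_{G\setminus\{e,e'\}}(y)+y^{\kappa(H)-\kappa(G)}\,\mathcal T_H(y).$$ Moreover, if $G$ is undirected, then $$\mathcal T_G(y)=\mathcal T_{G\setminus\{e,e'\}}(y)+y^{1-\deg_G(e^-,e^+)}\,\mathcal T_{H\setminus e'}(y).$$ -/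

import Mathlib

/-- A directed multigraph with vertex set `V` and arc set `A`; loops and parallel arcs are allowed. -/
structure MultiDigraph (V A : Type*) where
  /-- the tail (starting vertex) of an arc -/
  tail : A → V
  /-- the head (end vertex) of an arc -/
  head : A → V

namespace MultiDigraph

variable {V A : Type*}

/-- The number of arcs from `u` to `v`. -/
noncomputable def numArcs (G : MultiDigraph V A) (u v : V) : ℕ :=
  {a : A | G.tail a = u ∧ G.head a = v}.ncard

/-- The out-degree of `v`; every loop at `v` counts once. -/
noncomputable def outDeg (G : MultiDigraph V A) (v : V) : ℕ :=
  {a : A | G.tail a = v}.ncard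

/-- The in-degree of `v`; every loop at `v` counts once. -/
noncomputable def inDeg (G : MultiDigraph V A) (v : V) : ℕ :=
  {a : A | G.head a = v}.ncard

/-- There is an arc from `u` to `v`. -/
def HasArc (G : MultiDigraph V A) (u v : V) : Prop :=
  ∃ a : A, G.tail a = u ∧ G.head a = v

/-- Connectedness of the underlying undirected graph. -/
def IsConnected (G : MultiDigraph V A) : Prop :=
  Nonempty V ∧ ∀ u v : V, Relation.ReflTransGen (fun x y => G.HasArc x y ∨ G.HasArc y x) u v

/-- Strong connectedness: there is a directed path between any two vertices, in both directions. -/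
def IsStronglyConnected (G : MultiDigraph V A) : Prop :=
  Nonempty V ∧ ∀ u v : V, Relation.ReflTransGen G.HasArc u v

/-- Eulerian digraphs: connected, and the in-degree equals the out-degree at every vertex. -/
def IsEulerian (G : MultiDigraph V A) : Prop :=
  G.IsConnected ∧ ∀ v : V, G.inDeg v = G.outDeg v

/-- A digraph is undirected if there are as many arcs from `u` to `v` as from `v` to `u`. -/
def IsUndirected (G : MultiDigraph V A) : Prop :=
  ∀ u v : V, G.numArcs u v = G.numArcs v u

/-- The digraph in which the arcs in `S` are deleted. -/
def deleteArcs (G : MultiDigraph V A) (S : Set A) : MultiDigraph V {a : A // a ∉ S} where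
  tail a := G.tail a
  head a := G.head a

/-- `e` is a loop. -/
def IsLoop (G : MultiDigraph V A) (e : A) : Prop := G.tail e = G.head e

/-- `e` is a bridge: deleting it destroys strong connectedness. -/
def IsBridge (G : MultiDigraph V A) (e : A) : Prop :=
  ¬ (G.deleteArcs {e}).IsStronglyConnected

/-- `e'` is a reverse arc of `e`. -/
def IsReverse (G : MultiDigraph V A) (e e' : A) : Prop :=
  G.tail e' = G.head e ∧ G.head e' = G.tail e

/-- The digraph in which all loops are deleted. -/
def deleteLoops (G : MultiDigraph V A) : MultiDigraph V {a : A // a ∉ {a : A | G.IsLoop a}} :=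
  G.deleteArcs {a : A | G.IsLoop a}

/-- The vertices after contraction of `e`: `none` is the new vertex that replaces both endpoints
of `e`, and `some v` is a vertex `v` that is not an endpoint of `e`. -/
abbrev ContractVertex (G : MultiDigraph V A) (e : A) : Type _ :=
  Option {v : V // v ≠ G.tail e ∧ v ≠ G.head e}

open Classical in
/-- The map that sends the endpoints of `e` to the new vertex and keeps every other vertex. -/
noncomputable def contractMap (G : MultiDigraph V A) (e : A) (v : V) : G.ContractVertex e :=
  if h : v ≠ G.tail e ∧ v ≠ G.head e then some ⟨v, h⟩ else none

/-- The contraction of the arc `e`: `e` is removed, its endpoints are replaced by a single new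
vertex, and the remaining arcs are redirected accordingly. -/
noncomputable def contract (G : MultiDigraph V A) (e : A) :
    MultiDigraph (G.ContractVertex e) {a : A // a ≠ e} where
  tail a := G.contractMap e (G.tail a)
  head a := G.contractMap e (G.head a)

/-! The chip-firing game on `G` with sink `s`. -/

/-- Configurations: numbers of chips on the vertices other than the sink `s`. -/
abbrev Config (s : V) : Type _ := {v : V // v ≠ s} → ℕ

/-- The vertex `v` is firable in `c`: it holds at least as many chips as its out-degree, and some
arc that is not a loop leaves it. -/
def Firable (G : MultiDigraph V A) {s : V} (c : Config s) (v : {v : V // v ≠ s}) : Prop :=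
  G.outDeg v ≤ c v ∧ G.numArcs v v < G.outDeg v

/-- `c'` is obtained from `c` by firing one firable vertex `v`, which sends one chip along each of
its outgoing arcs (so that chips sent along loops stay at `v`); chips sent to the sink vanish. -/
def Fires (G : MultiDigraph V A) {s : V} (c c' : Config s) : Prop :=
  ∃ v : {v : V // v ≠ s}, G.Firable c v ∧
    c' v + G.outDeg v = c v + G.numArcs v v ∧
    ∀ u : {v : V // v ≠ s}, u ≠ v → c' u = c u + G.numArcs v u

/-- No vertex is firable. -/
def IsStable (G : MultiDigraph V A) {s : V} (c : Config s) : Prop :=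
  ∀ v : {v : V // v ≠ s}, ¬ G.Firable c v

/-- `c'` is a stable configuration reached from `c` by finitely many (possibly no) firings, that
is, `c'` is the stabilization of `c`. -/
def StabilizesTo (G : MultiDigraph V A) {s : V} (c c' : Config s) : Prop :=
  Relation.ReflTransGen G.Fires c c' ∧ G.IsStable c'

/-- A stable configuration is recurrent if it can be reached from every configuration by adding
chips and then stabilizing. -/
def IsRecurrent (G : MultiDigraph V A) {s : V} (c : Config s) : Prop :=
  G.IsStable c ∧ ∀ d : Config s, ∃ d' : Config s, G.StabilizesTo (d + d') c

/-- The out-degree of the sink plus the number of chips on the other vertices. -/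
noncomputable def chipSum (G : MultiDigraph V A) {s : V} (c : Config s) : ℕ :=
  G.outDeg s + ∑ᶠ v : {v : V // v ≠ s}, c v

/-- The minimum of `chipSum` over the recurrent configurations (with sink `s`) of the digraph
obtained from `G` by deleting all loops. -/
noncomputable def kappa (G : MultiDigraph V A) (s : V) : ℕ :=
  sInf {n : ℕ | ∃ c : Config s, G.deleteLoops.IsRecurrent c ∧ G.deleteLoops.chipSum c = n}

/-- The level of a configuration. Here `chipSum` is taken in `G` itself, loops included. -/
noncomputable def level (G : MultiDigraph V A) {s : V} (c : Config s) : ℤ :=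
  (G.chipSum c : ℤ) - (G.kappa s : ℤ)

/-- The generating function of the recurrent configurations by level, as a Laurent polynomial
over the integers, computed with sink `s`. (There are finitely many recurrent configurations.) -/
noncomputable def tutte (G : MultiDigraph V A) (s : V) : LaurentPolynomial ℤ :=
  ∑ᶠ c ∈ {c : Config s | G.IsRecurrent c}, LaurentPolynomial.T (G.level c)

end MultiDigraph

/-!
The proof works with rankings `r : V → ℤ` of the vertices. To a ranking belongs the vector
`lateInDeg`, which counts at `v` the arcs from vertices not ranked below `v`. Three facts about an
Eulerian digraph carry the argument.

*Burning* (`isRecurrent_iff`). A stable configuration is recurrent if and only if it dominates the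
vector of a ranking with the sink first. Domination survives firings (move the fired vertex to the
end), and holds for all large configurations. Conversely, every class modulo the Laplacian contains
at most one stable configuration that dominates such a vector (`eq_of_isStable_of_isBurnable`), and
contains arbitrarily large configurations, which then have to stabilize to it.

*Independence of the sink* (`recurrentSum_eq`). Completing a configuration on the sink to total
degree `d` identifies the recurrent configurations with `chipSum` at most `d` with the classes of
degree `d`, modulo firings of all vertices, that contain a distribution dominating the vector of
some ranking. Any vertex can be rotated to the front of a ranking, so this set of classes does not
depend on the sink.

*Deletion and contraction* (`recurrentSum_eq_add`). Take the tail of `e` as sink. The recurrent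
configurations in which the head of `e` is one chip short of its out-degree are those of the
contraction. All others are exactly the recurrent configurations after the deletion of `e` and `e'`.

In the first formula, the numbers `kappa` cancel. In the second, they are known: for an undirected
digraph `kappa` is half the number of arcs that are not loops (`two_mul_kappa`), since a ranking
selects one arc of each antiparallel pair. The arc `e'` is a loop of the contraction, and its deletion
only shifts the generating function (`recurrentSum_deleteArcs_singleton`).
-/

namespace MultiDigraph

/-! ### Rankings, the Laplacian, and uniqueness -/

section Multiplicity

variable {V : Type*} [Fintype V] (m : V → V → ℕ)

/-- For a ranking `r` of the vertices, the number of arcs into `v` whose tail is ranked no lower than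
`v`; loops at `v` count. Rankings need not be injective, and ties are counted. With these numbers
of chips, the vertices of an Eulerian digraph can fire once each, in the order of `r`. -/
def lateInDeg (r : V → ℤ) (v : V) : ℤ := ∑ u with r v ≤ r u, (m u v : ℤ)

/-- The Laplacian of `m`. If in- and out-degrees agree, firing every vertex `v` exactly `f v` times
turns a chip distribution `D` into `D - laplacian m f`. -/
def laplacian (f : V → ℤ) (v : V) : ℤ := ∑ u, (m u v : ℤ) * (f v - f u)

variable {m}

lemma lateInDeg_nonneg (r : V → ℤ) (v : V) : 0 ≤ lateInDeg m r v :=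
  Finset.sum_nonneg fun _ _ => by positivity

lemma lateInDeg_le (r : V → ℤ) (v : V) : lateInDeg m r v ≤ ∑ u, (m u v : ℤ) :=
  Finset.sum_le_sum_of_subset_of_nonneg (Finset.filter_subset _ _) fun _ _ _ => by positivity

lemma lateInDeg_eq_of_forall_le {r : V → ℤ} {v : V} (h : ∀ u, r v ≤ r u) :
    lateInDeg m r v = ∑ u, (m u v : ℤ) := by
  simp [lateInDeg, h]

lemma laplacian_add (f g : V → ℤ) (v : V) :
    laplacian m (f + g) v = laplacian m f v + laplacian m g v := by
  simp only [laplacian, Pi.add_apply, ← Finset.sum_add_distrib]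
  exact Finset.sum_congr rfl fun _ _ => by ring

lemma laplacian_smul (k : ℤ) (f : V → ℤ) (v : V) :
    laplacian m (k • f) v = k * laplacian m f v := by
  simp only [laplacian, Pi.smul_apply, smul_eq_mul, Finset.mul_sum]
  exact Finset.sum_congr rfl fun _ _ => by ring

lemma laplacian_neg (f : V → ℤ) (v : V) : laplacian m (-f) v = -laplacian m f v := by
  simpa using laplacian_smul (m := m) (-1) f v

lemma laplacian_zero (v : V) : laplacian m 0 v = 0 := by simp [laplacian]

lemma laplacian_indicator_self [DecidableEq V] (v : V) :
    laplacian m (Pi.single v 1) v = ∑ u, (m u v : ℤ) - m v v := by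
  simp only [laplacian, Pi.single_eq_same, mul_sub, mul_one, Finset.sum_sub_distrib]
  simp [Pi.single_apply]

lemma laplacian_indicator_of_ne [DecidableEq V] {u v : V} (h : u ≠ v) :
    laplacian m (Pi.single v 1) u = -(m v u : ℤ) := by
  simp [laplacian, Pi.single_apply, h]

lemma sum_laplacian (hm : ∀ v, ∑ u, m u v = ∑ u, m v u) (f : V → ℤ) :
    ∑ v, laplacian m f v = 0 := by
  have hm' : ∀ v, ∑ u, (m u v : ℤ) = ∑ u, (m v u : ℤ) := fun v => by exact_mod_cast hm v
  simp only [laplacian, mul_sub, Finset.sum_sub_distrib]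
  rw [sub_eq_zero, Finset.sum_comm (f := fun v u => (m u v : ℤ) * f u)]
  exact Finset.sum_congr rfl fun v _ => by rw [← Finset.sum_mul, ← Finset.sum_mul, hm']

/-- If `D` is stable and firing `f` leads from `D` to a `D'` that dominates some `lateInDeg m r`, then
`f` is maximal at the sink. Otherwise look at the lowest ranked vertex among those that fire most
often: it has lost a chip for every arc from outside this set, and keeps too few for `hD'`. -/
lemma le_sink_of_laplacian {s : V} {D D' f : V → ℤ} {r : V → ℤ}
    (hD : ∀ v ≠ s, D v < ∑ u, (m u v : ℤ)) (hD' : ∀ v ≠ s, lateInDeg m r v ≤ D' v)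
    (hf : ∀ v ≠ s, D' v = D v - laplacian m f v) (v : V) : f v ≤ f s := by
  by_contra! hv
  obtain ⟨x, -, hx⟩ := Finset.exists_max_image Finset.univ f ⟨s, Finset.mem_univ s⟩
  obtain ⟨y, hyS, hy⟩ := Finset.exists_min_image (Finset.univ.filter fun u => f u = f x) r
    ⟨x, by simp⟩
  have hyx : f y = f x := by simpa using hyS
  have hys : y ≠ s := by
    rintro rfl
    have := hx v (Finset.mem_univ v)
    omega
  have key : ∑ u, (m u y : ℤ) ≤ lateInDeg m r y + laplacian m f y := by
    rw [lateInDeg, laplacian, Finset.sum_filter, ← Finset.sum_add_distrib]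
    refine Finset.sum_le_sum fun u _ => ?_
    have h1 := hx u (Finset.mem_univ u)
    have h0 : (0 : ℤ) ≤ m u y := by positivity
    by_cases hu : f u = f x
    · have : r y ≤ r u := hy u (by simpa using hu)
      rw [if_pos this, hyx, hu]
      simp
    · have : 1 ≤ f y - f u := by omega
      have h2 : (0 : ℤ) ≤ if r y ≤ r u then (m u y : ℤ) else 0 := by split_ifs <;> omega
      nlinarith
  have := hD y hys
  have := hD' y hys
  have := hf y hys
  omega

/-- Two stable distributions that dominate vectors `lateInDeg m r` and differ by a Laplacian agree off
the sink. -/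
lemma eq_of_laplacian {s : V} {D D' f : V → ℤ} {r r' : V → ℤ}
    (hD : ∀ v ≠ s, D v < ∑ u, (m u v : ℤ)) (hr : ∀ v ≠ s, lateInDeg m r v ≤ D v)
    (hD' : ∀ v ≠ s, D' v < ∑ u, (m u v : ℤ)) (hr' : ∀ v ≠ s, lateInDeg m r' v ≤ D' v)
    (hf : ∀ v ≠ s, D' v = D v - laplacian m f v) {v : V} (hv : v ≠ s) : D v = D' v := by
  have h1 := le_sink_of_laplacian hD hr' hf
  have h2 := le_sink_of_laplacian (f := -f) hD' hr
    (fun v hv => by rw [hf v hv, laplacian_neg]; ring)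
  have h3 : ∀ u, f u = f s := fun u => by
    have := h1 u
    have := h2 u
    simp only [Pi.neg_apply] at this
    omega
  simp [hf v hv, laplacian, h3]

/-- If `D` dominates the vector of some ranking, then firing all vertices ranked below `s` gives a
distribution that dominates the vector of a ranking with `s` strictly first. -/
lemma exists_lateInDeg_le_sink_first {D r : V → ℤ}
    (hD : ∀ v, lateInDeg m r v ≤ D v) (s : V) :
    ∃ f r' : V → ℤ, (∀ v ≠ s, r' s < r' v) ∧
      ∀ v, lateInDeg m r' v ≤ D v - laplacian m f v := by
  classical
  obtain ⟨B, hB⟩ : ∃ B : ℤ, ∀ u v, r u - r v < B := by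
    obtain ⟨B, hB⟩ := (Set.finite_range fun x : V × V => r x.1 - r x.2).bddAbove
    exact ⟨B + 1, fun u v => Int.lt_add_one_of_le (hB ⟨(u, v), rfl⟩)⟩
  refine ⟨fun v => if r v < r s then 1 else 0,
    fun v => if v = s then r s - 1 else if r v < r s then r v + B else r v, ?_, ?_⟩
  · intro v hv
    have := hB s v
    simp only [if_true, if_neg hv]
    split_ifs <;> omega
  · intro v
    refine le_trans ?_ (sub_le_sub_right (hD v) _)
    rw [lateInDeg, lateInDeg, laplacian, Finset.sum_filter, Finset.sum_filter,
      ← Finset.sum_sub_distrib]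
    refine Finset.sum_le_sum fun u _ => ?_
    have h0 : (0 : ℤ) ≤ m u v := by positivity
    have := hB u v
    have := hB v u
    have := hB s v
    have := hB v s
    by_cases hus : u = s <;> by_cases hvs : v = s <;> by_cases hu : r u < r s <;>
      by_cases hv : r v < r s <;> by_cases huv : r v ≤ r u <;>
      simp [hus, hvs, hu, hv, huv] <;> (try split_ifs) <;> omega

end Multiplicity

/-! ### The maximum principle -/

section Potential

variable {V : Type*} [Fintype V] {m : V → V → ℕ}

/-- Maximum principle: a function that is subharmonic off `s` attains its maximum at `s`, provided
that no proper nonempty vertex set is closed under in-neighbours. -/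
lemma le_sink_of_subharmonic
    (hm : ∀ S : Set V, S.Nonempty → (∀ u v, v ∈ S → m u v ≠ 0 → u ∈ S) → S = Set.univ)
    {s : V} {w : V → ℚ} (hw : ∀ v ≠ s, ∑ u, (m u v : ℚ) * (w v - w u) ≤ 0) (v : V) :
    w v ≤ w s := by
  obtain ⟨x, -, hx⟩ := Finset.exists_max_image Finset.univ w ⟨s, Finset.mem_univ s⟩
  refine (hx v (Finset.mem_univ v)).trans (le_of_eq ?_)
  by_contra hxs
  have hS := hm {u | w u = w x} ⟨x, rfl⟩ fun u y (hy : w y = w x) huy => by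
    have hys : y ≠ s := by rintro rfl; exact hxs hy.symm
    have hnn : ∀ u ∈ Finset.univ, 0 ≤ (m u y : ℚ) * (w y - w u) := fun u hu =>
      mul_nonneg (by positivity) (by rw [hy]; linarith [hx u hu])
    have h0 := (Finset.sum_eq_zero_iff_of_nonneg hnn).1
      (le_antisymm (hw y hys) (Finset.sum_nonneg hnn)) u (Finset.mem_univ u)
    have : (m u y : ℚ) ≠ 0 := by exact_mod_cast huy
    have := (mul_eq_zero.1 h0).resolve_left this
    change w u = w x
    linarith
  have : s ∈ {u | w u = w x} := hS ▸ Set.mem_univ s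
  exact hxs this.symm

/-- There is a nonnegative integral function that vanishes at `s` and has positive Laplacian elsewhere.
It serves as a firing vector whose reversal enriches every vertex and, for the reversed digraph, as
a potential that decreases with every firing. -/
lemma exists_one_le_laplacian
    (hm : ∀ S : Set V, S.Nonempty → (∀ u v, v ∈ S → m u v ≠ 0 → u ∈ S) → S = Set.univ)
    (s : V) :
    ∃ f : V → ℤ, f s = 0 ∧ (∀ v, 0 ≤ f v) ∧ ∀ v ≠ s, 1 ≤ laplacian m f v := by
  classical
  let T : (V → ℚ) →ₗ[ℚ] (V → ℚ) :=
    { toFun := fun w v => if v = s then w s else ∑ u, (m u v : ℚ) * (w v - w u)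
      map_add' := fun w w' => by
        ext v
        by_cases hv : v = s
        · simp [hv]
        · simp only [Pi.add_apply, if_neg hv, ← Finset.sum_add_distrib]
          exact Finset.sum_congr rfl fun _ _ => by ring
      map_smul' := fun k w => by
        ext v
        by_cases hv : v = s
        · simp [hv]
        · simp only [Pi.smul_apply, smul_eq_mul, if_neg hv, Finset.mul_sum, RingHom.id_apply]
          exact Finset.sum_congr rfl fun _ _ => by ring }
  have hTs : ∀ w, T w s = w s := fun w => if_pos rfl
  have hT : ∀ w, ∀ v ≠ s, T w v = ∑ u, (m u v : ℚ) * (w v - w u) := fun w v hv => if_neg hv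
  have hinj : Function.Injective T := by
    rw [← LinearMap.ker_eq_bot, LinearMap.ker_eq_bot']
    intro w hw
    have hws : w s = 0 := by rw [← hTs w, hw, Pi.zero_apply]
    have h1 := le_sink_of_subharmonic hm (s := s) (w := w)
      fun v hv => by rw [← hT w v hv, hw, Pi.zero_apply]
    have h2 := le_sink_of_subharmonic hm (s := s) (w := -w)
      fun v hv => by rw [← hT _ v hv, map_neg, hw, neg_zero, Pi.zero_apply]
    ext v
    have := h1 v
    have := h2 v
    simp only [Pi.neg_apply, Pi.zero_apply] at *
    linarith
  obtain ⟨w, hw⟩ := LinearMap.injective_iff_surjective.1 hinj fun v => if v = s then 0 else 1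
  have hws : w s = 0 := by rw [← hTs w, hw]; exact if_pos rfl
  have hw1 : ∀ v ≠ s, ∑ u, (m u v : ℚ) * (w v - w u) = 1 := fun v hv => by
    rw [← hT w v hv, hw]; exact if_neg hv
  have hwnn : ∀ v, 0 ≤ w v := fun v => by
    have := le_sink_of_subharmonic hm (s := s) (w := -w)
      (fun v hv => by rw [← hT _ v hv, map_neg, hw]; simp [hv]) v
    simp only [Pi.neg_apply, hws] at this
    linarith
  -- Clear the denominators of the rational solution.
  have hN : ∃ N : ℕ, 0 < N ∧ ∀ v, ∃ k : ℤ, (k : ℚ) = N * w v := by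
    refine ⟨∏ v, (w v).den, Finset.prod_pos fun v _ => (w v).pos, fun v => ?_⟩
    obtain ⟨d, hd⟩ := Finset.dvd_prod_of_mem (fun v => (w v).den) (Finset.mem_univ v)
    refine ⟨d * (w v).num, ?_⟩
    rw [hd]
    push_cast
    rw [mul_comm ((w v).den : ℚ), mul_assoc, Rat.den_mul_eq_num]
  obtain ⟨N, hN0, hN⟩ := hN
  choose f hf using hN
  have hNQ : (0 : ℚ) < N := by exact_mod_cast hN0
  refine ⟨f, ?_, fun v => ?_, fun v hv => ?_⟩
  · have := hf s
    rw [hws, mul_zero] at this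
    exact_mod_cast this
  · have : (0 : ℚ) ≤ f v := by rw [hf]; exact mul_nonneg hNQ.le (hwnn v)
    exact_mod_cast this
  · have : ((laplacian m f v : ℤ) : ℚ) = N := by
      rw [laplacian]
      push_cast
      rw [← mul_one (N : ℚ), ← hw1 v hv, Finset.mul_sum]
      refine Finset.sum_congr rfl fun u _ => ?_
      rw [hf, hf]
      ring
    have : laplacian m f v = N := by exact_mod_cast this
    omega

end Potential

/-! ### Rankings of undirected digraphs -/

section UndirectedDegree

variable {V : Type*} [Fintype V] {m : V → V → ℕ}

lemma two_mul_sum_lateInDeg (hm : ∀ u v, m u v = m v u) (r : V → ℤ) :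
    2 * ∑ v, lateInDeg m r v =
      ∑ v, ∑ u, ((if r v ≤ r u then (m u v : ℤ) else 0) + if r u ≤ r v then (m u v : ℤ) else 0) := by
  simp only [lateInDeg, Finset.sum_filter, Finset.sum_add_distrib, two_mul]
  congr 1
  rw [Finset.sum_comm]
  simp only [hm]

lemma sum_le_two_mul_sum_lateInDeg (hm : ∀ u v, m u v = m v u) (r : V → ℤ) :
    ∑ v, ∑ u, (m u v : ℤ) ≤ 2 * ∑ v, lateInDeg m r v := by
  rw [two_mul_sum_lateInDeg hm]
  refine Finset.sum_le_sum fun v _ => Finset.sum_le_sum fun u _ => ?_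
  split_ifs <;> omega

lemma two_mul_sum_lateInDeg_of_injective (hm : ∀ u v, m u v = m v u) (hloop : ∀ v, m v v = 0)
    {r : V → ℤ} (hr : r.Injective) :
    2 * ∑ v, lateInDeg m r v = ∑ v, ∑ u, (m u v : ℤ) := by
  rw [two_mul_sum_lateInDeg hm]
  refine Finset.sum_congr rfl fun v _ => Finset.sum_congr rfl fun u _ => ?_
  by_cases huv : u = v
  · simp [huv, hloop]
  · have := hr.ne huv
    split_ifs <;> omega

end UndirectedDegree

/-! ### Degrees as sums of arc multiplicities -/

section Degrees

variable {V A : Type*} [Fintype V] [Finite A] (G : MultiDigraph V A)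

lemma sum_numArcs_left (v : V) : ∑ u, G.numArcs u v = G.inDeg v := by
  classical
  have := Fintype.ofFinite A
  simp only [numArcs, inDeg, Set.ncard_eq_toFinset_card']
  rw [Finset.card_eq_sum_card_fiberwise (f := G.tail) (t := Finset.univ) (by simp)]
  refine Finset.sum_congr rfl fun u _ => congrArg _ ?_
  ext a
  simp [and_comm]

lemma sum_numArcs_right (v : V) : ∑ u, G.numArcs v u = G.outDeg v := by
  classical
  have := Fintype.ofFinite A
  simp only [numArcs, outDeg, Set.ncard_eq_toFinset_card']
  rw [Finset.card_eq_sum_card_fiberwise (f := G.head) (t := Finset.univ) (by simp)]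
  refine Finset.sum_congr rfl fun u _ => congrArg _ ?_
  ext a
  simp

lemma sum_inDeg : ∑ v, G.inDeg v = Nat.card A := by
  classical
  have := Fintype.ofFinite A
  simp only [inDeg, Set.ncard_eq_toFinset_card', Nat.card_eq_fintype_card]
  rw [← Finset.card_univ,
    Finset.card_eq_sum_card_fiberwise (f := G.head) (t := Finset.univ) (by simp)]
  refine Finset.sum_congr rfl fun u _ => congrArg _ ?_
  ext a
  simp

end Degrees

/-! ### Connectedness by closed vertex sets -/

section Connectivity

variable {V A : Type*} {G : MultiDigraph V A}

lemma numArcs_ne_zero_iff [Finite A] {u v : V} : G.numArcs u v ≠ 0 ↔ G.HasArc u v := by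
  rw [numArcs, Ne, Set.ncard_eq_zero, ← Ne, ← Set.nonempty_iff_ne_empty]
  rfl

lemma isConnected_iff_forall_set :
    G.IsConnected ↔ Nonempty V ∧ ∀ S : Set V, S.Nonempty →
      (∀ a, G.tail a ∈ S ↔ G.head a ∈ S) → S = Set.univ := by
  refine and_congr_right fun _ => ⟨fun h S ⟨u, hu⟩ hS => ?_, fun h u v => ?_⟩
  · refine Set.eq_univ_of_forall fun v => ?_
    induction h u v with
    | refl => exact hu
    | tail _ hxy ih =>
      rcases hxy with ⟨a, rfl, rfl⟩ | ⟨a, rfl, rfl⟩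
      · exact (hS a).1 ih
      · exact (hS a).2 ih
  · have := h {v | Relation.ReflTransGen (fun x y => G.HasArc x y ∨ G.HasArc y x) u v}
      ⟨u, .refl⟩ fun a => ⟨fun ha => ha.tail (Or.inl ⟨a, rfl, rfl⟩),
        fun ha => ha.tail (Or.inr ⟨a, rfl, rfl⟩)⟩
    exact this.symm.subset (Set.mem_univ v)

/-- Eulerian digraphs are strongly connected: a set closed under in-neighbours is, by counting arcs,
closed under out-neighbours as well. -/
lemma IsEulerian.eq_univ_of_inClosed [Fintype V] [Finite A] (hG : G.IsEulerian) {S : Set V}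
    (hS : S.Nonempty) (hin : ∀ u v, v ∈ S → G.numArcs u v ≠ 0 → u ∈ S) : S = Set.univ := by
  classical
  have hle : ∀ u ∈ S.toFinset, ∑ v ∈ S.toFinset, G.numArcs u v ≤ G.outDeg u := fun u _ => by
    rw [← sum_numArcs_right]
    exact Finset.sum_le_sum_of_subset (Finset.subset_univ _)
  have heq : ∑ u ∈ S.toFinset, ∑ v ∈ S.toFinset, G.numArcs u v =
      ∑ u ∈ S.toFinset, G.outDeg u := by
    rw [Finset.sum_comm]
    refine Finset.sum_congr rfl fun v hv => ?_
    rw [← hG.2 v, ← sum_numArcs_left]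
    refine Finset.sum_subset (Finset.subset_univ _) fun u _ hu => ?_
    by_contra hne
    exact hu (Set.mem_toFinset.2 (hin u v (Set.mem_toFinset.1 hv) hne))
  have hout : ∀ u v, u ∈ S → G.numArcs u v ≠ 0 → v ∈ S := fun u v hu huv => by
    by_contra hv
    have h1 := (Finset.sum_eq_sum_iff_of_le hle).1 heq u (Set.mem_toFinset.2 hu)
    rw [← sum_numArcs_right] at h1
    exact (Finset.sum_lt_sum_of_subset (Finset.subset_univ _) (Finset.mem_univ v)
      (by simpa using hv) (Nat.pos_of_ne_zero huv) fun _ _ _ => Nat.zero_le _).ne h1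
  refine (isConnected_iff_forall_set.1 hG.1).2 S hS fun a => ⟨fun h => hout _ _ h ?_,
    fun h => hin _ _ h ?_⟩ <;>
  exact numArcs_ne_zero_iff.2 ⟨a, rfl, rfl⟩

end Connectivity

/-! ### Stabilization and the burning criterion -/

section ChipFiring

variable {V A : Type*} [Fintype V] [Finite A] {G : MultiDigraph V A} {s : V}

/-- A configuration is burnable if it dominates `lateInDeg` off the sink for a ranking with the sink
strictly first. This is Dhar's criterion: after the sink has fired, all other vertices can fire once
each, in the order of the ranking. -/
def IsBurnable (G : MultiDigraph V A) (c : Config s) : Prop :=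
  ∃ r : V → ℤ, (∀ v ≠ s, r s < r v) ∧ ∀ v : {v : V // v ≠ s}, lateInDeg G.numArcs r v ≤ c v

lemma IsEulerian.sum_numArcs_eq (hG : G.IsEulerian) (v : V) :
    ∑ u, (G.numArcs u v : ℤ) = G.outDeg v := by
  rw [← hG.2, ← sum_numArcs_left]
  push_cast
  rfl

lemma IsEulerian.sum_numArcs_comm (hG : G.IsEulerian) (v : V) :
    ∑ u, G.numArcs u v = ∑ u, G.numArcs v u := by
  rw [sum_numArcs_left, sum_numArcs_right, hG.2]

lemma isBurnable_of_outDeg_le (hG : G.IsEulerian) {c : Config s}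
    (hc : ∀ v : {v : V // v ≠ s}, G.outDeg v ≤ c v) : G.IsBurnable c := by
  classical
  refine ⟨fun v => if v = s then 0 else 1, fun v hv => by simp [hv], fun v => ?_⟩
  refine (lateInDeg_le _ _).trans ?_
  rw [hG.sum_numArcs_eq]
  exact_mod_cast hc v

lemma IsEulerian.numArcs_self_lt (hG : G.IsEulerian) {v : V} (hv : v ≠ s) :
    G.numArcs v v < G.outDeg v := by
  classical
  rw [← hG.2, ← sum_numArcs_left]
  obtain ⟨u, huv, hu⟩ : ∃ u, u ≠ v ∧ G.numArcs u v ≠ 0 := by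
    by_contra! h
    have := hG.eq_univ_of_inClosed (S := {v}) ⟨v, rfl⟩ fun u w hw huw => by
      by_contra huv
      exact huw (by rw [Set.mem_singleton_iff.1 hw]; exact h u huv)
    exact hv (this.symm.subset (Set.mem_univ s)).symm
  rw [← Finset.add_sum_erase _ _ (Finset.mem_univ v)]
  have := Finset.single_le_sum (f := fun u => G.numArcs u v) (fun _ _ => Nat.zero_le _)
    (Finset.mem_erase.2 ⟨huv, Finset.mem_univ u⟩)
  omega

lemma isStable_iff (hG : G.IsEulerian) {c : Config s} :
    G.IsStable c ↔ ∀ v : {v : V // v ≠ s}, c v < G.outDeg v :=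
  forall_congr' fun v => by
    rw [Firable, not_and_or, not_le, or_iff_left (not_not.2 (hG.numArcs_self_lt v.2))]

lemma Fires.exists_laplacian [DecidableEq V] (hG : G.IsEulerian) {c c' : Config s}
    (h : G.Fires c c') : ∃ v : {v : V // v ≠ s}, (G.outDeg v ≤ c v) ∧
      ∀ u : {v : V // v ≠ s}, (c' u : ℤ) = c u - laplacian G.numArcs (Pi.single v.1 1) u := by
  obtain ⟨v, hv, h1, h2⟩ := h
  refine ⟨v, hv.1, fun u => ?_⟩
  by_cases huv : u = v
  · rw [huv, laplacian_indicator_self, hG.sum_numArcs_eq]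
    omega
  · rw [laplacian_indicator_of_ne (Subtype.coe_ne_coe.2 huv), h2 u huv]
    push_cast
    ring

lemma exists_laplacian_of_reflTransGen (hG : G.IsEulerian) {c c' : Config s}
    (h : Relation.ReflTransGen G.Fires c c') : ∃ f : V → ℤ, f s = 0 ∧ (∀ v, 0 ≤ f v) ∧
      ∀ u : {v : V // v ≠ s}, (c' u : ℤ) = c u - laplacian G.numArcs f u := by
  classical
  induction h with
  | refl => exact ⟨0, rfl, fun _ => le_rfl, fun u => by rw [laplacian_zero, sub_zero]⟩
  | tail _ hf ih =>
    obtain ⟨f, hfs, hf0, hfc⟩ := ih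
    obtain ⟨v, -, hv⟩ := hf.exists_laplacian hG
    refine ⟨f + Pi.single v.1 1, ?_, fun u => add_nonneg (hf0 u) ?_, fun u => ?_⟩
    · simp [hfs, v.2.symm]
    · rw [Pi.single_apply]
      split_ifs <;> simp
    · rw [hv, hfc, laplacian_add]
      ring

/-- Firing `v` preserves burnability: move `v` to the end of the ranking. -/
lemma IsBurnable.fires (hG : G.IsEulerian) {c c' : Config s} (hc : G.IsBurnable c)
    (h : G.Fires c c') : G.IsBurnable c' := by
  classical
  obtain ⟨r, hrs, hr⟩ := hc
  obtain ⟨v, hv, hc'⟩ := h.exists_laplacian hG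
  obtain ⟨B, hB⟩ : ∃ B : ℤ, ∀ u, r u < B := by
    obtain ⟨B, hB⟩ := (Set.finite_range r).bddAbove
    exact ⟨B + 1, fun u => Int.lt_add_one_of_le (hB ⟨u, rfl⟩)⟩
  refine ⟨Function.update r v B, fun u hu => ?_, fun u => ?_⟩
  · rw [Function.update_of_ne v.2.symm]
    by_cases huv : u = v
    · rw [huv, Function.update_self]
      exact hB s
    · rw [Function.update_of_ne huv]
      exact hrs u hu
  · by_cases huv : u = v
    · rw [hc', huv, laplacian_indicator_self, hG.sum_numArcs_eq, lateInDeg, Finset.sum_filter,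
        Finset.sum_eq_single v.1]
      · simp only [le_refl, if_true]
        omega
      · intro w _ hw
        simp [Function.update_of_ne hw, hB w]
      · simp
    · have huv' := Subtype.coe_ne_coe.2 huv
      rw [hc', laplacian_indicator_of_ne huv', sub_neg_eq_add]
      refine le_trans ?_ (add_le_add_left (hr u) _)
      rw [lateInDeg, lateInDeg, Finset.sum_filter, Finset.sum_filter,
        ← Finset.add_sum_erase _ _ (Finset.mem_univ v.1), add_comm,
        ← Finset.add_sum_erase (a := v.1) (f := fun w => if r u ≤ r w then _ else _) _
          (Finset.mem_univ v.1)]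
      refine add_le_add ?_ ?_
      · refine le_trans (Finset.sum_le_sum fun w hw => ?_)
          (le_add_of_nonneg_left (by split_ifs <;> simp))
        rw [Function.update_of_ne (Finset.ne_of_mem_erase hw), Function.update_of_ne huv']
      · split_ifs <;> simp

lemma IsBurnable.reflTransGen (hG : G.IsEulerian) {c c' : Config s} (hc : G.IsBurnable c)
    (h : Relation.ReflTransGen G.Fires c c') : G.IsBurnable c' := by
  induction h with
  | refl => exact hc
  | tail _ hf ih => exact ih.fires hG hf

/-- Every configuration stabilizes: the chips weighted by a potential for the reversed digraph lose
weight with every firing. -/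
lemma exists_stabilizesTo (hG : G.IsEulerian) (c : Config s) : ∃ c', G.StabilizesTo c c' := by
  classical
  obtain ⟨w, hws, hw0, hw⟩ := exists_one_le_laplacian (m := fun u v => G.numArcs v u)
    (fun S hS hout => by
      by_contra hne
      have := hG.eq_univ_of_inClosed (S := Sᶜ) (Set.nonempty_compl.2 hne)
        fun u v hv huv hu => hv (hout v u hu huv)
      exact hS.ne_empty (Set.compl_univ_iff.1 this)) s
  let Φ : Config s → ℤ := fun c => ∑ v : {v : V // v ≠ s}, w v * c v
  have hΦ0 : ∀ c, 0 ≤ Φ c := fun c => Finset.sum_nonneg fun v _ =>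
    mul_nonneg (hw0 v) (by positivity)
  have hstep : ∀ c c' : Config s, G.Fires c c' → Φ c' < Φ c := fun c c' h => by
    obtain ⟨v, -, hc'⟩ := h.exists_laplacian hG
    have h1 : Φ c' = Φ c - ∑ u, w u * laplacian G.numArcs (Pi.single v.1 1) u := by
      rw [Fintype.sum_eq_add_sum_subtype_ne _ s, hws, zero_mul, zero_add, ← Finset.sum_sub_distrib]
      exact Finset.sum_congr rfl fun u _ => by rw [hc']; ring
    have h2 : ∑ u, w u * laplacian G.numArcs (Pi.single v.1 1) u =
        laplacian (fun u v => G.numArcs v u) w v := by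
      have h3 : ∀ u, w u * laplacian G.numArcs (Pi.single v.1 1) u =
          (if u = v.1 then w v * G.outDeg v else 0) - w u * G.numArcs v u := fun u => by
        by_cases huv : u = v
        · rw [huv, laplacian_indicator_self, hG.sum_numArcs_eq, if_pos rfl]
          ring
        · rw [laplacian_indicator_of_ne huv, if_neg huv]
          ring
      simp only [h3]
      simp only [Finset.sum_sub_distrib, Finset.sum_ite_eq', Finset.mem_univ, if_true,
        laplacian, mul_sub]
      rw [← sum_numArcs_right]
      push_cast
      rw [Finset.mul_sum]
      exact congrArg₂ _ (Finset.sum_congr rfl fun _ _ => mul_comm _ _)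
        (Finset.sum_congr rfl fun _ _ => mul_comm _ _)
    have := hw v v.2
    omega
  induction hn : (Φ c).toNat using Nat.strong_induction_on generalizing c with
  | _ n ih =>
    by_cases hc : G.IsStable c
    · exact ⟨c, .refl, hc⟩
    · rw [IsStable] at hc
      push Not at hc
      obtain ⟨v, hv⟩ := hc
      let c₁ : Config s := fun u =>
        if u = v then c v + G.numArcs v v - G.outDeg v else c u + G.numArcs v u
      have hf : G.Fires c c₁ := by
        refine ⟨v, hv, ?_, fun u hu => if_neg hu⟩
        have := hv.1
        simp only [c₁, if_true]
        omega
      have := hstep c c₁ hf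
      have := hΦ0 c₁
      obtain ⟨c', h1, h2⟩ := ih _ (by omega) c₁ rfl
      exact ⟨c', h1.head hf, h2⟩

open Classical in
/-- The configuration `c` with `a` chips put on the sink, where `a` may be negative. -/
noncomputable def extend (c : Config s) (a : ℤ) (v : V) : ℤ :=
  if h : v ≠ s then c ⟨v, h⟩ else a

omit [Fintype V] in
@[simp] lemma extend_sink (c : Config s) (a : ℤ) : extend c a s = a := by simp [extend]

omit [Fintype V] in
lemma extend_of_ne (c : Config s) (a : ℤ) {v : V} (hv : v ≠ s) : extend c a v = c ⟨v, hv⟩ := by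
  simp [extend, hv]

lemma sum_extend [Fintype {v : V // v ≠ s}] (c : Config s) (a : ℤ) :
    ∑ v, extend c a v = a + ∑ v, (c v : ℤ) := by
  classical
  rw [Fintype.sum_eq_add_sum_subtype_ne _ s, extend_sink]
  refine congrArg _ (Finset.sum_congr (by ext; simp) fun v _ => extend_of_ne c a v.2)

/-- A class modulo the Laplacian contains at most one stable burnable configuration. -/
lemma eq_of_isStable_of_isBurnable (hG : G.IsEulerian) {c c' : Config s} (hc : G.IsStable c)
    (hcb : G.IsBurnable c) (hc' : G.IsStable c') (hcb' : G.IsBurnable c') {f : V → ℤ}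
    (hf : ∀ v : {v : V // v ≠ s}, (c' v : ℤ) = c v - laplacian G.numArcs f v) : c = c' := by
  obtain ⟨r, -, hr⟩ := hcb
  obtain ⟨r', -, hr'⟩ := hcb'
  rw [isStable_iff hG] at hc hc'
  ext v
  have := eq_of_laplacian (m := G.numArcs) (D := extend c 0) (D' := extend c' 0) (f := f) (r := r)
    (r' := r') (s := s)
    (fun v hv => by rw [extend_of_ne _ _ hv, hG.sum_numArcs_eq]; exact_mod_cast hc ⟨v, hv⟩)
    (fun v hv => by rw [extend_of_ne _ _ hv]; exact hr ⟨v, hv⟩)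
    (fun v hv => by rw [extend_of_ne _ _ hv, hG.sum_numArcs_eq]; exact_mod_cast hc' ⟨v, hv⟩)
    (fun v hv => by rw [extend_of_ne _ _ hv]; exact hr' ⟨v, hv⟩)
    (fun v hv => by rw [extend_of_ne _ _ hv, extend_of_ne _ _ hv]; exact hf ⟨v, hv⟩) v.2
  rw [extend_of_ne _ _ v.2, extend_of_ne _ _ v.2] at this
  exact_mod_cast this

/-- The burning criterion: recurrent means stable and burnable. -/
theorem isRecurrent_iff (hG : G.IsEulerian) {c : Config s} :
    G.IsRecurrent c ↔ G.IsStable c ∧ G.IsBurnable c := by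
  refine and_congr_right fun hst => ⟨fun h => ?_, fun hb d => ?_⟩
  · obtain ⟨d', hd', -⟩ := h fun v => G.outDeg v
    exact (isBurnable_of_outDeg_le hG fun v => Nat.le_add_right _ _).reflTransGen hG hd'
  · -- Add to `c` a large multiple of a positive Laplacian, to have at least `d` chips everywhere.
    obtain ⟨f, -, -, hf⟩ := exists_one_le_laplacian (m := G.numArcs)
      (fun S hS h => hG.eq_univ_of_inClosed hS h) s
    obtain ⟨N, hN⟩ : ∃ N : ℕ, ∀ v : {v : V // v ≠ s}, d v + G.outDeg v ≤ N := by
      obtain ⟨N, hN⟩ := (Set.finite_range fun v : {v : V // v ≠ s} => d v + G.outDeg v).bddAbove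
      exact ⟨N, fun v => hN ⟨v, rfl⟩⟩
    have hb' : ∀ v : {v : V // v ≠ s}, ∃ k : ℕ, (k : ℤ) =
        c v + N * laplacian G.numArcs f v - d v ∧ G.outDeg v ≤ k := fun v => by
      have h1 := hf v v.2
      have h2 := hN v
      have h3 : (N : ℤ) ≤ N * laplacian G.numArcs f v := by nlinarith
      exact ⟨(c v + N * laplacian G.numArcs f v - d v).toNat, by omega, by omega⟩
    choose d' hd' hdeg using hb'
    refine ⟨d', ?_⟩
    obtain ⟨c', hc', hcs'⟩ := exists_stabilizesTo hG (d + d')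
    have hbb : G.IsBurnable (d + d') :=
      isBurnable_of_outDeg_le hG fun v => (hdeg v).trans (Nat.le_add_left _ _)
    obtain ⟨g, -, -, hg⟩ := exists_laplacian_of_reflTransGen hG hc'
    have : c = c' := eq_of_isStable_of_isBurnable hG hst hb hcs' (hbb.reflTransGen hG hc')
      (f := -((N : ℤ) • f) + g) fun v => by
        rw [hg, laplacian_add, laplacian_neg, laplacian_smul, Pi.add_apply]
        push_cast
        rw [hd']
        ring
    exact this ▸ ⟨hc', hcs'⟩

lemma finite_setOf_isRecurrent (hG : G.IsEulerian) : {c : Config s | G.IsRecurrent c}.Finite :=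
  (Set.Finite.pi' fun v : {v : V // v ≠ s} => Set.finite_Iic (G.outDeg v)).subset fun _ hc v =>
    ((isStable_iff hG).1 hc.1 v).le

end ChipFiring

/-! ### Sums determined by distribution functions -/

section Counting

lemma card_filter_le_succ {α : Type*} (S : Finset α) (f : α → ℕ) (d : ℕ) :
    (S.filter (f · ≤ d + 1)).card =
      (S.filter (f · ≤ d)).card + (S.filter (f · = d + 1)).card := by
  classical
  rw [← Finset.card_union_of_disjoint, ← Finset.filter_or]
  · simp only [Nat.le_succ_iff]
  · exact Finset.disjoint_filter.2 fun _ _ _ _ => by omega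

lemma card_filter_eq_of_card_filter_le {α β : Type*} {S : Finset α} {S' : Finset β} {f : α → ℕ}
    {g : β → ℕ} (h : ∀ d, (S.filter (f · ≤ d)).card = (S'.filter (g · ≤ d)).card) (d : ℕ) :
    (S.filter (f · = d)).card = (S'.filter (g · = d)).card := by
  cases d with
  | zero => simpa using h 0
  | succ d =>
    have h1 := h d
    have h2 := h (d + 1)
    rw [card_filter_le_succ, card_filter_le_succ] at h2
    omega

lemma sum_comp_eq_of_card_filter_le {α β M : Type*} [AddCommMonoid M] {S : Finset α}
    {S' : Finset β} {f : α → ℕ} {g : β → ℕ}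
    (h : ∀ d, (S.filter (f · ≤ d)).card = (S'.filter (g · ≤ d)).card) (F : ℕ → M) :
    ∑ a ∈ S, F (f a) = ∑ b ∈ S', F (g b) := by
  classical
  have : S.val.map f = S'.val.map g := by
    ext d
    have := card_filter_eq_of_card_filter_le h d
    simp only [Finset.card_def, Finset.filter_val] at this
    rw [Multiset.count_map, Multiset.count_map]
    simpa only [eq_comm] using this
  simpa using congrArg (fun M => (M.map F).sum) this

end Counting

/-! ### Independence of the sink -/

section SinkIndependence

variable {V A : Type*} [Fintype V] [Finite A] {G : MultiDigraph V A}

/-- The generating function of the recurrent configurations by `chipSum`, that is, `tutte` before the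
normalization by `kappa`. -/
noncomputable def recurrentSum (G : MultiDigraph V A) (s : V) : LaurentPolynomial ℤ :=
  ∑ᶠ c ∈ {c : Config s | G.IsRecurrent c}, LaurentPolynomial.T (G.chipSum c : ℤ)

/-- Equivalence of chip distributions on all vertices: firing some vertices, the sink included, any
positive or negative numbers of times. -/
def firingSetoid (G : MultiDigraph V A) : Setoid (V → ℤ) where
  r D D' := ∃ f : V → ℤ, ∀ v, D' v = D v - laplacian G.numArcs f v
  iseqv :=
    { refl := fun D => ⟨0, fun v => by rw [laplacian_zero, sub_zero]⟩
      symm := fun ⟨f, hf⟩ => ⟨-f, fun v => by rw [hf, laplacian_neg]; ring⟩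
      trans := fun ⟨f, hf⟩ ⟨g, hg⟩ => ⟨f + g, fun v => by rw [hg, hf, laplacian_add]; ring⟩ }

/-- The distribution of total degree `d` that agrees with `c` off the sink. -/
noncomputable def fullConfig {s : V} (d : ℕ) (c : Config s) : V → ℤ :=
  extend c (d - ∑ᶠ v, (c v : ℤ))

omit [Fintype V] [Finite A] in
lemma chipSum_cast [Finite V] {s : V} (c : Config s) :
    (G.chipSum c : ℤ) = G.outDeg s + ∑ᶠ v, (c v : ℤ) := by
  classical
  have := Fintype.ofFinite V
  simp [chipSum, finsum_eq_sum_of_fintype]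

omit [Finite A] in
lemma fullConfig_sink {s : V} (d : ℕ) (c : Config s) :
    fullConfig d c s = d - G.chipSum c + G.outDeg s := by
  rw [fullConfig, extend_sink, chipSum_cast]
  ring

lemma sum_fullConfig {s : V} (d : ℕ) (c : Config s) : ∑ v, fullConfig d c v = d := by
  classical
  rw [fullConfig, sum_extend, finsum_eq_sum_of_fintype]
  ring

lemma IsEulerian.eq_sub_laplacian_of_sum_eq (hG : G.IsEulerian) {s : V} {D D' f : V → ℤ}
    (h : ∀ v ≠ s, D' v = D v - laplacian G.numArcs f v) (hsum : ∑ v, D v = ∑ v, D' v) (v : V) :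
    D' v = D v - laplacian G.numArcs f v := by
  classical
  by_cases hv : v = s
  · have h0 := sum_laplacian hG.sum_numArcs_comm f
    rw [← Finset.add_sum_erase _ _ (Finset.mem_univ s)] at h0 hsum
    rw [← Finset.add_sum_erase (a := s) (f := D') _ (Finset.mem_univ s),
      Finset.sum_congr rfl fun v hv => h v (Finset.ne_of_mem_erase hv),
      Finset.sum_sub_distrib] at hsum
    rw [hv]
    omega
  · exact h v hv

/-- A distribution of degree `d` that dominates `lateInDeg` for some ranking is equivalent to the
completion of a recurrent configuration, and this leaves at least the out-degree on the sink. -/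
lemma exists_isRecurrent_of_lateInDeg_le (hG : G.IsEulerian) {d : ℕ} {D r : V → ℤ}
    (hr : ∀ v, lateInDeg G.numArcs r v ≤ D v) (hD : ∑ v, D v = d) (s : V) :
    ∃ c : Config s, G.IsRecurrent c ∧ G.chipSum c ≤ d ∧
      (firingSetoid G).r D (fullConfig d c) := by
  obtain ⟨f, r', hr's, hr'⟩ := exists_lateInDeg_le_sink_first hr s
  set D' : V → ℤ := fun v => D v - laplacian G.numArcs f v with hD'
  have hD'0 : ∀ v, 0 ≤ D' v := fun v => (lateInDeg_nonneg _ _).trans (hr' v)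
  have hD's : (G.outDeg s : ℤ) ≤ D' s := by
    rw [← hG.sum_numArcs_eq, ← lateInDeg_eq_of_forall_le (r := r') (v := s)]
    · exact hr' s
    · intro u
      by_cases hu : u = s
      · rw [hu]
      · exact (hr's u hu).le
  let c₀ : Config s := fun v => (D' v).toNat
  have hc₀ : ∀ v : {v : V // v ≠ s}, (c₀ v : ℤ) = D' v := fun v => Int.toNat_of_nonneg (hD'0 v)
  have hb : G.IsBurnable c₀ := ⟨r', hr's, fun v => by rw [hc₀]; exact hr' v⟩
  obtain ⟨c, hc, hst⟩ := exists_stabilizesTo hG c₀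
  obtain ⟨g, hgs, hg0, hg⟩ := exists_laplacian_of_reflTransGen hG hc
  have hDD' : (firingSetoid G).r D D' := ⟨f, fun v => rfl⟩
  have hsum : ∑ v, D' v = ∑ v, fullConfig d c v := by
    rw [sum_fullConfig, ← hD, hD', Finset.sum_sub_distrib, sum_laplacian hG.sum_numArcs_comm,
      sub_zero]
  have hDc := hG.eq_sub_laplacian_of_sum_eq (s := s) (f := g) (fun v hv => by
    rw [fullConfig, extend_of_ne _ _ hv, hg, hc₀]) hsum
  refine ⟨c, (isRecurrent_iff hG).2 ⟨hst, hb.reflTransGen hG hc⟩, ?_,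
    (firingSetoid G).iseqv.trans hDD' ⟨g, hDc⟩⟩
  have h1 := hDc s
  rw [fullConfig_sink (G := G)] at h1
  have h2 : laplacian G.numArcs g s ≤ 0 := Finset.sum_nonpos fun u _ =>
    mul_nonpos_of_nonneg_of_nonpos (by positivity) (by rw [hgs]; linarith [hg0 u])
  omega

lemma IsRecurrent.exists_lateInDeg_le (hG : G.IsEulerian) {s : V} {c : Config s}
    (hc : G.IsRecurrent c) {d : ℕ} (hd : G.chipSum c ≤ d) :
    ∃ r : V → ℤ, ∀ v, lateInDeg G.numArcs r v ≤ fullConfig d c v := by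
  obtain ⟨r, -, hr⟩ := ((isRecurrent_iff hG).1 hc).2
  refine ⟨r, fun v => ?_⟩
  by_cases hv : v = s
  · rw [hv, fullConfig_sink (G := G)]
    have := lateInDeg_le (m := G.numArcs) r s
    rw [hG.sum_numArcs_eq] at this
    omega
  · rw [fullConfig, extend_of_ne _ _ hv]
    exact hr ⟨v, hv⟩

/-- The recurrent configurations with `chipSum` at most `d` correspond to the classes of degree `d`
that contain a distribution dominating some `lateInDeg`. The latter do not involve the sink. -/
lemma ncard_isRecurrent_chipSum_le (hG : G.IsEulerian) (s : V) (d : ℕ) :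
    {c : Config s | G.IsRecurrent c ∧ G.chipSum c ≤ d}.ncard =
      {x : Quotient (firingSetoid G) | ∃ D r : V → ℤ, (∀ v, lateInDeg G.numArcs r v ≤ D v) ∧
        ∑ v, D v = d ∧ Quotient.mk (firingSetoid G) D = x}.ncard := by
  rw [← Set.InjOn.ncard_image
    (f := fun c : Config s => Quotient.mk (firingSetoid G) (fullConfig d c))]
  · congr 1
    ext x
    constructor
    · rintro ⟨c, ⟨hc, hd⟩, rfl⟩
      obtain ⟨r, hr⟩ := hc.exists_lateInDeg_le hG hd
      exact ⟨fullConfig d c, r, hr, sum_fullConfig d c, rfl⟩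
    · rintro ⟨D, r, hr, hD, rfl⟩
      obtain ⟨c, hc, hd, h⟩ := exists_isRecurrent_of_lateInDeg_le hG hr hD s
      exact ⟨c, ⟨hc, hd⟩, Quotient.sound ((firingSetoid G).iseqv.symm h)⟩
  · rintro c ⟨hc, -⟩ c' ⟨hc', -⟩ h
    obtain ⟨f, hf⟩ : (firingSetoid G).r _ _ := Quotient.exact h
    rw [isRecurrent_iff hG] at hc hc'
    refine eq_of_isStable_of_isBurnable hG hc.1 hc.2 hc'.1 hc'.2 (f := f) fun v => ?_
    simpa only [fullConfig, extend_of_ne _ _ v.2] using hf v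

theorem recurrentSum_eq (hG : G.IsEulerian) (s t : V) : G.recurrentSum s = G.recurrentSum t := by
  classical
  rw [recurrentSum, recurrentSum, finsum_mem_eq_finite_toFinset_sum _ (finite_setOf_isRecurrent hG),
    finsum_mem_eq_finite_toFinset_sum _ (finite_setOf_isRecurrent hG)]
  refine sum_comp_eq_of_card_filter_le (fun d => ?_) fun n : ℕ => LaurentPolynomial.T (n : ℤ)
  have key : ∀ s : V, ((finite_setOf_isRecurrent (s := s) hG).toFinset.filter
      (G.chipSum · ≤ d)).card = {c : Config s | G.IsRecurrent c ∧ G.chipSum c ≤ d}.ncard :=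
    fun s => by
      rw [← Set.ncard_coe_finset]
      congr 1
      ext c
      simp
  rw [key, key, ncard_isRecurrent_chipSum_le hG, ncard_isRecurrent_chipSum_le hG]

/-- `tutte` is `recurrentSum`, computed with any sink `t`, shifted by `kappa` for its own sink `s`. -/
lemma tutte_eq_T_mul_recurrentSum (hG : G.IsEulerian) (s t : V) :
    G.tutte s = LaurentPolynomial.T (-(G.kappa s : ℤ)) * G.recurrentSum t := by
  rw [← recurrentSum_eq hG s, recurrentSum, tutte,
    finsum_mem_eq_finite_toFinset_sum _ (finite_setOf_isRecurrent hG),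
    finsum_mem_eq_finite_toFinset_sum _ (finite_setOf_isRecurrent hG), Finset.mul_sum]
  refine Finset.sum_congr rfl fun c _ => ?_
  rw [← LaurentPolynomial.T_add, level]
  congr 1
  ring

/-- In a loopless undirected Eulerian digraph the minimal `chipSum` is half the number of arcs: a
ranking counts one arc of each antiparallel pair, or both in case of a tie. -/
lemma two_mul_sInf_chipSum (hG : G.IsEulerian) (hU : G.IsUndirected)
    (hloop : ∀ a, ¬ G.IsLoop a) (s : V) :
    2 * sInf {n : ℕ | ∃ c : Config s, G.IsRecurrent c ∧ G.chipSum c = n} = Nat.card A := by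
  classical
  have hcard : ∑ v, ∑ u, (G.numArcs u v : ℤ) = Nat.card A := by
    rw [← sum_inDeg G]
    push_cast
    exact Finset.sum_congr rfl fun v _ => by rw [← sum_numArcs_left]; push_cast; rfl
  set X := {n : ℕ | ∃ c : Config s, G.IsRecurrent c ∧ G.chipSum c = n} with hX
  have hlow : ∀ n ∈ X, Nat.card A ≤ 2 * n := by
    rintro n ⟨c, hc, rfl⟩
    obtain ⟨r, hr⟩ := hc.exists_lateInDeg_le hG le_rfl
    have h1 := Finset.sum_le_sum fun v (_ : v ∈ Finset.univ) => hr v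
    rw [sum_fullConfig] at h1
    have h2 := sum_le_two_mul_sum_lateInDeg hU r
    omega
  have hr : Function.Injective fun v : V => ((Fintype.equivFin V v : ℕ) : ℤ) := fun u v h => by
    exact (Fintype.equivFin V).injective (Fin.ext (Nat.cast_injective h))
  have h2 := two_mul_sum_lateInDeg_of_injective (m := G.numArcs) hU (fun v => by
    by_contra h
    obtain ⟨a, h1, h2⟩ := numArcs_ne_zero_iff.1 h
    exact hloop a (h1.trans h2.symm)) hr
  set r := fun v : V => ((Fintype.equivFin V v : ℕ) : ℤ)
  have h0 : 0 ≤ ∑ v, lateInDeg G.numArcs r v := Finset.sum_nonneg fun v _ => lateInDeg_nonneg r v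
  obtain ⟨c, hc, hcd, -⟩ := exists_isRecurrent_of_lateInDeg_le hG (r := r) (fun v => le_rfl)
    (Int.toNat_of_nonneg h0).symm s
  have h3 := hlow _ (Nat.sInf_mem (s := X) ⟨_, c, hc, rfl⟩)
  have h4 : sInf X ≤ G.chipSum c := Nat.sInf_le ⟨c, hc, rfl⟩
  omega

end SinkIndependence

/-! ### Deleting arcs -/

section Deletion

variable {V A : Type*} [Finite A] (G : MultiDigraph V A)

lemma ncard_subtype_add_ncard (S : Set A) (P : A → Prop) :
    {a : {a : A // a ∉ S} | P a}.ncard + {a | a ∈ S ∧ P a}.ncard = {a | P a}.ncard := by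
  rw [← Set.ncard_image_of_injective _ Subtype.val_injective, ← Set.ncard_union_eq]
  · congr 1
    ext a
    by_cases ha : a ∈ S <;> simp [ha]
  · rw [Set.disjoint_left]
    rintro _ ⟨a, -, rfl⟩ ⟨ha, -⟩
    exact a.2 ha

lemma outDeg_deleteArcs (S : Set A) (v : V) :
    (G.deleteArcs S).outDeg v + {a | a ∈ S ∧ G.tail a = v}.ncard = G.outDeg v :=
  ncard_subtype_add_ncard S fun a => G.tail a = v

lemma inDeg_deleteArcs (S : Set A) (v : V) :
    (G.deleteArcs S).inDeg v + {a | a ∈ S ∧ G.head a = v}.ncard = G.inDeg v :=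
  ncard_subtype_add_ncard S fun a => G.head a = v

lemma numArcs_deleteArcs (S : Set A) (u v : V) :
    (G.deleteArcs S).numArcs u v + {a | a ∈ S ∧ G.tail a = u ∧ G.head a = v}.ncard =
      G.numArcs u v :=
  ncard_subtype_add_ncard S fun a => G.tail a = u ∧ G.head a = v

variable {G}

omit [Finite A] in
lemma ncard_setOf_mem_pair_and {e e' : A} {P Q : A → Prop} (h : P e ↔ Q e') (h' : P e' ↔ Q e) :
    {a | a ∈ ({e, e'} : Set A) ∧ P a}.ncard = {a | a ∈ ({e, e'} : Set A) ∧ Q a}.ncard := by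
  classical
  rw [← Set.ncard_image_of_injective _ (Equiv.swap e e').injective]
  congr 1
  ext a
  simp only [Set.mem_image, Set.mem_ofPred_eq, Set.mem_insert_iff, Set.mem_singleton_iff]
  constructor
  · rintro ⟨b, ⟨rfl | rfl, hb⟩, rfl⟩
    · rw [Equiv.swap_apply_left]
      exact ⟨Or.inr rfl, h.1 hb⟩
    · rw [Equiv.swap_apply_right]
      exact ⟨Or.inl rfl, h'.1 hb⟩
  · rintro ⟨rfl | rfl, ha⟩
    · exact ⟨e', ⟨Or.inr rfl, h'.2 ha⟩, Equiv.swap_apply_right _ _⟩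
    · exact ⟨e, ⟨Or.inl rfl, h.2 ha⟩, Equiv.swap_apply_left _ _⟩

lemma IsEulerian.deleteArcs_of_isLoop (hG : G.IsEulerian) {S : Set A}
    (hS : ∀ a ∈ S, G.IsLoop a) : (G.deleteArcs S).IsEulerian := by
  refine ⟨isConnected_iff_forall_set.2 ⟨hG.1.1, fun X hX h => ?_⟩, fun v => ?_⟩
  · refine (isConnected_iff_forall_set.1 hG.1).2 X hX fun a => ?_
    by_cases ha : a ∈ S
    · rw [(hS a ha : G.tail a = G.head a)]
    · exact h ⟨a, ha⟩
  · have h1 := outDeg_deleteArcs G S v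
    have h2 := inDeg_deleteArcs G S v
    have h3 : {a | a ∈ S ∧ G.head a = v} = {a | a ∈ S ∧ G.tail a = v} :=
      Set.ext fun a => and_congr_right fun ha => by rw [(hS a ha : G.tail a = G.head a)]
    rw [h3] at h2
    have := hG.2 v
    omega

lemma IsUndirected.deleteArcs_of_isLoop (hG : G.IsUndirected) {S : Set A}
    (hS : ∀ a ∈ S, G.IsLoop a) : (G.deleteArcs S).IsUndirected := fun u v => by
  have h1 := numArcs_deleteArcs G S u v
  have h2 := numArcs_deleteArcs G S v u
  have h3 : {a | a ∈ S ∧ G.tail a = u ∧ G.head a = v} =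
      {a | a ∈ S ∧ G.tail a = v ∧ G.head a = u} :=
    Set.ext fun a => and_congr_right fun ha => by
      rw [(hS a ha : G.tail a = G.head a), and_comm]
  rw [h3] at h1
  have := hG u v
  omega

lemma IsUndirected.deleteArcs_pair (hG : G.IsUndirected) {e e' : A} (hrev : G.IsReverse e e') :
    (G.deleteArcs {e, e'}).IsUndirected := fun u v => by
  have h1 := numArcs_deleteArcs G {e, e'} u v
  have h2 := numArcs_deleteArcs G {e, e'} v u
  rw [ncard_setOf_mem_pair_and (Q := fun a => G.tail a = v ∧ G.head a = u)
    (by rw [hrev.1, hrev.2, and_comm]) (by rw [hrev.1, hrev.2, and_comm])] at h1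
  have := hG u v
  omega

omit [Finite A] in
lemma mem_of_reflTransGen {X : Set V} (h : ∀ a, G.tail a ∈ X → G.head a ∈ X) {u v : V}
    (huv : Relation.ReflTransGen G.HasArc u v) (hu : u ∈ X) : v ∈ X := by
  induction huv with
  | refl => exact hu
  | tail _ hxy ih =>
    obtain ⟨a, rfl, rfl⟩ := hxy
    exact h a ih

/-- Deleting an arc that is not a bridge along with a reverse arc keeps an Eulerian digraph Eulerian. -/
lemma IsEulerian.deleteArcs_pair (hG : G.IsEulerian) {e e' : A} (hbridge : ¬ G.IsBridge e)
    (hrev : G.IsReverse e e') : (G.deleteArcs {e, e'}).IsEulerian := by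
  rw [IsBridge, not_not] at hbridge
  refine ⟨isConnected_iff_forall_set.2 ⟨hG.1.1, fun X hX h => ?_⟩, fun v => ?_⟩
  · replace h : ∀ a, a ≠ e → a ≠ e' → (G.tail a ∈ X ↔ G.head a ∈ X) := fun a h1 h2 =>
      h ⟨a, by simp [h1, h2]⟩
    -- Otherwise `e'` is the only arc of `G \ e` between `X` and its complement, so `X` can be
    -- left or entered in `G \ e`, but not both.
    have hends : G.tail e ∈ X ↔ G.head e ∈ X := by
      refine ⟨fun hp => by_contra fun hq => ?_, fun hq => by_contra fun hp => ?_⟩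
      · refine hq (mem_of_reflTransGen (fun a ha => ?_) (hbridge.2 (G.tail e) (G.head e)) hp)
        by_cases hae : a.1 = e'
        · exact absurd (show G.tail a.1 ∈ X from ha) (by rwa [hae, hrev.1])
        · exact (h a a.2 hae).1 ha
      · refine mem_of_reflTransGen (X := Xᶜ) (fun a ha => ?_)
          (hbridge.2 (G.tail e) (G.head e)) hp hq
        by_cases hae : a.1 = e'
        · exact absurd (show G.tail a.1 ∈ Xᶜ from ha) (by
            rwa [hae, hrev.1, Set.mem_compl_iff, not_not])
        · exact fun hy => ha ((h a a.2 hae).2 hy)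
    refine (isConnected_iff_forall_set.1 hG.1).2 X hX fun a => ?_
    by_cases h1 : a = e
    · rw [h1, hends]
    by_cases h2 : a = e'
    · rw [h2, hrev.1, hrev.2, hends]
    exact h a h1 h2
  · have h1 := outDeg_deleteArcs G {e, e'} v
    have h2 := inDeg_deleteArcs G {e, e'} v
    rw [ncard_setOf_mem_pair_and (Q := fun a => G.head a = v)
      (by rw [hrev.2]) (by rw [hrev.1])] at h1
    have := hG.2 v
    omega

lemma two_mul_kappa [Finite V] (hG : G.IsEulerian) (hU : G.IsUndirected) (s : V) :
    2 * G.kappa s = {a | ¬ G.IsLoop a}.ncard := by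
  have := Fintype.ofFinite V
  rw [kappa, two_mul_sInf_chipSum (G := G.deleteLoops)
    (hG.deleteArcs_of_isLoop (S := {a | G.IsLoop a}) fun _ h => h)
    (hU.deleteArcs_of_isLoop (S := {a | G.IsLoop a}) fun _ h => h) (fun a ha => a.2 ha)]
  rfl

end Deletion

/-! ### Loops at the sink -/

section Transfer

variable {V A B : Type*} [Fintype V] {s : V} {G : MultiDigraph V A} {K : MultiDigraph V B}

lemma IsBurnable.congr (h : ∀ u ≠ s, ∀ v ≠ s, G.numArcs u v = K.numArcs u v) {c : Config s}
    (hc : G.IsBurnable c) : K.IsBurnable c := by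
  obtain ⟨r, hrs, hr⟩ := hc
  refine ⟨r, hrs, fun v => (hr v).trans' (le_of_eq (Finset.sum_congr rfl fun u hu => ?_))⟩
  have hus : u ≠ s := by
    rintro rfl
    exact absurd (Finset.mem_filter.1 hu).2 (not_le.2 (hrs v v.2))
  rw [h u hus v v.2]

lemma isBurnable_congr (h : ∀ u ≠ s, ∀ v ≠ s, G.numArcs u v = K.numArcs u v) {c : Config s} :
    G.IsBurnable c ↔ K.IsBurnable c :=
  ⟨fun hc => hc.congr h, fun hc => hc.congr fun u hu v hv => (h u hu v hv).symm⟩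

/-- A loop at the sink affects only the summand `outDeg s` of `chipSum`. -/
lemma recurrentSum_deleteArcs_singleton [Finite A] (hG : G.IsEulerian) {a : A} (ha : G.IsLoop a)
    (hs : G.tail a = s) :
    G.recurrentSum s = LaurentPolynomial.T 1 * (G.deleteArcs {a}).recurrentSum s := by
  have hs' : G.head a = s := (show G.tail a = G.head a from ha) ▸ hs
  have hK := hG.deleteArcs_of_isLoop (S := {a}) (by rintro _ rfl; exact ha)
  have hout : ∀ v ≠ s, (G.deleteArcs {a}).outDeg v = G.outDeg v := fun v hv => by
    rw [← outDeg_deleteArcs G {a}, show {b | b ∈ ({a} : Set A) ∧ G.tail b = v} = ∅ from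
      Set.eq_empty_of_forall_notMem (by rintro _ ⟨rfl, h⟩; exact hv (h ▸ hs)), Set.ncard_empty]
    rfl
  have hnum : ∀ u ≠ s, ∀ v ≠ s, G.numArcs u v = (G.deleteArcs {a}).numArcs u v :=
    fun u hu v _ => by
      rw [← numArcs_deleteArcs G {a},
        show {b | b ∈ ({a} : Set A) ∧ G.tail b = u ∧ G.head b = v} = ∅ from
          Set.eq_empty_of_forall_notMem (by rintro _ ⟨rfl, h, -⟩; exact hu (h ▸ hs)),
        Set.ncard_empty]
      rfl
  have hout_s : (G.deleteArcs {a}).outDeg s + 1 = G.outDeg s := by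
    rw [← outDeg_deleteArcs G {a}, show {b | b ∈ ({a} : Set A) ∧ G.tail b = s} = {a} from
      Set.ext fun b => ⟨fun h => h.1, by rintro rfl; exact ⟨rfl, hs⟩⟩, Set.ncard_singleton]
  have hrec : {c : Config s | G.IsRecurrent c} = {c | (G.deleteArcs {a}).IsRecurrent c} := by
    ext c
    rw [Set.mem_ofPred, Set.mem_ofPred, isRecurrent_iff hG, isRecurrent_iff hK, isStable_iff hG,
      isStable_iff hK, isBurnable_congr hnum]
    exact and_congr_left fun _ => forall_congr' fun v => by rw [hout v v.2]
  rw [recurrentSum, recurrentSum, hrec,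
    finsum_mem_eq_finite_toFinset_sum _ (finite_setOf_isRecurrent hK),
    finsum_mem_eq_finite_toFinset_sum _ (finite_setOf_isRecurrent hK), Finset.mul_sum]
  refine Finset.sum_congr rfl fun c _ => ?_
  rw [← LaurentPolynomial.T_add, chipSum_cast, chipSum_cast, ← hout_s]
  congr 1
  push_cast
  ring

end Transfer

/-! ### Contracting an arc -/

section Contraction

variable {V A : Type*} (G : MultiDigraph V A)

/-- The digraph obtained by renaming or identifying vertices along `π`, with the same arcs. -/
def mapVertices {W : Type*} (π : V → W) : MultiDigraph W A where
  tail a := π (G.tail a)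
  head a := π (G.head a)

variable {G}

section Map

variable [Finite V] [Finite A] {W : Type*} {π : V → W}

lemma IsEulerian.mapVertices (hG : G.IsEulerian) (hπ : π.Surjective) :
    (G.mapVertices π).IsEulerian := by
  classical
  have := Fintype.ofFinite A
  have := Fintype.ofFinite V
  refine ⟨isConnected_iff_forall_set.2 ⟨hG.1.1.map π, fun X ⟨x, hx⟩ h => ?_⟩, fun w => ?_⟩
  · obtain ⟨v, rfl⟩ := hπ x
    have := (isConnected_iff_forall_set.1 hG.1).2 (π ⁻¹' X) ⟨v, hx⟩ h
    exact Set.eq_univ_of_forall fun y => by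
      obtain ⟨u, rfl⟩ := hπ y
      exact this.symm.subset (Set.mem_univ u)
  · have key : ∀ f : A → V, {a | π (f a) = w}.ncard =
        ∑ v with π v = w, {a | f a = v}.ncard := fun f => by
      simp only [Set.ncard_eq_toFinset_card']
      rw [Finset.card_eq_sum_card_fiberwise (f := f) (t := Finset.univ.filter (π · = w))
        (fun a ha => by simpa using ha)]
      refine Finset.sum_congr rfl fun v hv => congrArg _ (Finset.ext fun a => ?_)
      have : π v = w := by simpa using hv
      simp only [Finset.mem_filter, Set.mem_toFinset, Set.mem_ofPred_eq, and_iff_right_iff_imp]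
      rintro rfl
      exact this
    exact (key G.head).trans ((Finset.sum_congr rfl fun v _ => hG.2 v).trans (key G.tail).symm)

lemma IsUndirected.mapVertices (hG : G.IsUndirected) : (G.mapVertices π).IsUndirected := by
  classical
  have := Fintype.ofFinite A
  have := Fintype.ofFinite V
  have key : ∀ x y, (G.mapVertices π).numArcs x y =
      ∑ p : V × V with π p.1 = x ∧ π p.2 = y, G.numArcs p.1 p.2 := fun x y => by
    simp only [numArcs, Set.ncard_eq_toFinset_card']
    rw [Finset.card_eq_sum_card_fiberwise (f := fun a => (G.tail a, G.head a))
      (t := Finset.univ.filter fun p : V × V => π p.1 = x ∧ π p.2 = y)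
      (fun a ha => Finset.mem_coe.2 (Finset.mem_filter.2 ⟨Finset.mem_univ _,
        by
        rw [Finset.mem_coe, Set.mem_toFinset] at ha
        exact ha⟩))]
    refine Finset.sum_congr rfl fun p hp => congrArg _ (Finset.ext fun a => ?_)
    have : π p.1 = x ∧ π p.2 = y := by simpa using hp
    simp only [Finset.mem_filter, Set.mem_toFinset, Set.mem_ofPred_eq, Prod.ext_iff,
      and_iff_right_iff_imp]
    rintro ⟨h1, h2⟩
    rwa [← h1, ← h2] at this
  intro x y
  rw [key, key]
  refine Finset.sum_equiv (Equiv.prodComm V V) (fun p => ?_) fun p _ => hG _ _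
  simp [and_comm]

end Map

variable {e e' : A}

lemma contractMap_surjective : (G.contractMap e).Surjective := by
  classical
  intro x
  cases x with
  | none => exact ⟨G.tail e, by simp [contractMap]⟩
  | some v => exact ⟨v, by simp only [contractMap, dif_pos v.2]⟩

lemma contractMap_eq_some {u : V} {v : {v : V // v ≠ G.tail e ∧ v ≠ G.head e}} :
    G.contractMap e u = some v ↔ u = v := by
  rw [contractMap]
  split_ifs with h
  · rw [Option.some_inj, Subtype.ext_iff]
  · exact ⟨fun h => absurd h (by simp), fun huv => absurd (huv ▸ v.2) h⟩

lemma contractMap_eq_none {u : V} :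
    G.contractMap e u = none ↔ u = G.tail e ∨ u = G.head e := by
  rw [contractMap]
  split_ifs with h
  · simp [h.1, h.2]
  · simpa only [not_and_or, not_not, true_iff] using h

lemma isLoop_mapVertices_self : (G.mapVertices (G.contractMap e)).IsLoop e :=
  (contractMap_eq_none.2 (Or.inl rfl)).trans (contractMap_eq_none.2 (Or.inr rfl)).symm

lemma IsEulerian.contract [Finite V] [Finite A] (hG : G.IsEulerian) : (G.contract e).IsEulerian :=
  (hG.mapVertices contractMap_surjective).deleteArcs_of_isLoop (S := {e})
    (by rintro _ rfl; exact isLoop_mapVertices_self)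

lemma IsUndirected.contract [Finite V] [Finite A] (hG : G.IsUndirected) :
    (G.contract e).IsUndirected :=
  (hG.mapVertices (π := G.contractMap e)).deleteArcs_of_isLoop (S := {e})
    (by rintro _ rfl; exact isLoop_mapVertices_self)

variable [Finite A]

lemma numArcs_contract (u v : {v : V // v ≠ G.tail e ∧ v ≠ G.head e}) :
    (G.contract e).numArcs (some u) (some v) = G.numArcs u v := by
  have h : (G.contract e).numArcs (some u) (some v) + _ = _ :=
    numArcs_deleteArcs (G.mapVertices (G.contractMap e)) {e} (some u) (some v)
  rw [show {a | a ∈ ({e} : Set A) ∧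
    (G.mapVertices (G.contractMap e)).tail a = some u ∧
    (G.mapVertices (G.contractMap e)).head a = some v} = ∅ from
      Set.eq_empty_of_forall_notMem (by
        rintro _ ⟨rfl, h, -⟩
        exact u.2.1 (contractMap_eq_some.1 h).symm), Set.ncard_empty, add_zero] at h
  refine h.trans ?_
  rw [numArcs, numArcs]
  congr 1
  ext a
  exact and_congr contractMap_eq_some contractMap_eq_some

lemma outDeg_contract_some (v : {v : V // v ≠ G.tail e ∧ v ≠ G.head e}) :
    (G.contract e).outDeg (some v) = G.outDeg v := by
  have h : (G.contract e).outDeg (some v) + _ = _ :=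
    outDeg_deleteArcs (G.mapVertices (G.contractMap e)) {e} (some v)
  rw [show {a | a ∈ ({e} : Set A) ∧
    (G.mapVertices (G.contractMap e)).tail a = some v} = ∅ from
      Set.eq_empty_of_forall_notMem (by
        rintro _ ⟨rfl, h⟩
        exact v.2.1 (contractMap_eq_some.1 h).symm), Set.ncard_empty, add_zero] at h
  refine h.trans ?_
  rw [outDeg, outDeg]
  congr 1
  ext a
  exact contractMap_eq_some

lemma outDeg_contract_none (hloop : ¬ G.IsLoop e) :
    (G.contract e).outDeg none + 1 = G.outDeg (G.tail e) + G.outDeg (G.head e) := by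
  have h : (G.contract e).outDeg none + _ = _ :=
    outDeg_deleteArcs (G.mapVertices (G.contractMap e)) {e} none
  rw [show {a | a ∈ ({e} : Set A) ∧
    (G.mapVertices (G.contractMap e)).tail a = none} = {e} from
      Set.ext fun a => ⟨fun h => h.1, by
        rintro rfl
        exact ⟨rfl, contractMap_eq_none.2 (Or.inl rfl)⟩⟩, Set.ncard_singleton] at h
  refine h.trans ?_
  rw [outDeg, outDeg, outDeg, ← Set.ncard_union_eq]
  · congr 1
    ext a
    exact contractMap_eq_none
  · rw [Set.disjoint_left]
    exact fun a (h1 : G.tail a = G.tail e) h2 => hloop (h1.symm.trans h2)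

lemma sum_eq_add_add_sum_subtype [Fintype V] {p q : V} (hpq : p ≠ q)
    [Fintype {v : V // v ≠ p ∧ v ≠ q}] {M : Type*} [AddCommMonoid M] (F : V → M) :
    ∑ v, F v = F p + F q + ∑ v : {v : V // v ≠ p ∧ v ≠ q}, F v := by
  classical
  rw [← Finset.sum_filter_add_sum_filter_not _ fun v => v ≠ p ∧ v ≠ q, add_comm]
  congr 1
  · rw [← Finset.sum_pair hpq]
    refine Finset.sum_congr (Finset.ext fun v => ?_) fun _ _ => rfl
    simp only [Finset.mem_filter, Finset.mem_univ, true_and, Finset.mem_insert,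
      Finset.mem_singleton]
    tauto
  · exact Finset.sum_subtype _ (by simp) F

/-- Vertices ranked after both endpoints of `e` do not notice the contraction. -/
lemma lateInDeg_contract [Fintype V] [hF : Fintype (G.ContractVertex e)] (hloop : ¬ G.IsLoop e)
    {r : V → ℤ} {ρ : G.ContractVertex e → ℤ} (h : ∀ u, ρ (some u) = r u)
    {v : {v : V // v ≠ G.tail e ∧ v ≠ G.head e}} (hp : r (G.tail e) < r v)
    (hq : r (G.head e) < r v) (hρ : ρ none < ρ (some v)) :
    lateInDeg (G.contract e).numArcs ρ (some v) = lateInDeg G.numArcs r v := by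
  classical
  obtain rfl : hF = instFintypeOption := Subsingleton.elim _ _
  rw [lateInDeg, lateInDeg, Finset.sum_filter, Finset.sum_filter, sum_eq_add_add_sum_subtype hloop,
    if_neg (not_le.2 hp), if_neg (not_le.2 hq), zero_add, zero_add]
  refine (Fintype.sum_option (α := {v : V // v ≠ G.tail e ∧ v ≠ G.head e}) (M := ℤ) _).trans ?_
  rw [if_neg (not_le.2 hρ), zero_add]
  refine Finset.sum_congr rfl fun u _ => ?_
  rw [h, h, numArcs_contract]

end Contraction

/-! ### The deletion-contraction recursion -/

section DeletionContraction

variable {V A : Type*} [Fintype V] [Finite A] {G : MultiDigraph V A} {e e' : A}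

open Classical in
/-- The configuration of `G` with sink `tail e` that puts the largest stable number of chips on `head e`
and agrees with `d`, a configuration of the contraction with the new vertex as sink, elsewhere. -/
noncomputable def uncontractConfig (G : MultiDigraph V A) (e : A)
    (d : Config (none : G.ContractVertex e)) : Config (G.tail e) := fun v =>
  if h : v.1 = G.head e then G.outDeg (G.head e) - 1 else d ⟨some ⟨v, v.2, h⟩, Option.some_ne_none _⟩

omit [Fintype V] [Finite A] in
lemma uncontractConfig_head (d : Config (none : G.ContractVertex e))
    (h : G.head e ≠ G.tail e) : uncontractConfig G e d ⟨G.head e, h⟩ = G.outDeg (G.head e) - 1 :=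
  dif_pos rfl

omit [Fintype V] [Finite A] in
lemma uncontractConfig_of_ne (d : Config (none : G.ContractVertex e))
    (v : {v : V // v ≠ G.tail e ∧ v ≠ G.head e}) :
    uncontractConfig G e d ⟨v, v.2.1⟩ = d ⟨some v, Option.some_ne_none _⟩ :=
  dif_neg v.2.2

omit [Fintype V] in
lemma one_le_outDeg (a : A) : 1 ≤ G.outDeg (G.tail a) :=
  (Set.ncard_pos (Set.toFinite _)).2 ⟨a, rfl⟩

lemma chipSum_uncontractConfig (hloop : ¬ G.IsLoop e) (hq : 1 ≤ G.outDeg (G.head e))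
    (d : Config (none : G.ContractVertex e)) :
    G.chipSum (uncontractConfig G e d) = (G.contract e).chipSum d := by
  classical
  -- Both completions to total degree `0` sum to zero.
  have h1 := sum_fullConfig 0 (uncontractConfig G e d)
  have h2 := sum_fullConfig 0 d
  rw [sum_eq_add_add_sum_subtype hloop, fullConfig_sink (G := G)] at h1
  rw [Fintype.sum_option, fullConfig_sink (G := G.contract e)] at h2
  have h3 : fullConfig 0 (uncontractConfig G e d) (G.head e) = G.outDeg (G.head e) - 1 := by
    rw [fullConfig, extend_of_ne _ _ (Ne.symm hloop), uncontractConfig_head]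
    omega
  have h4 : ∀ v : {v : V // v ≠ G.tail e ∧ v ≠ G.head e},
      fullConfig 0 (uncontractConfig G e d) v = fullConfig 0 d (some v) := fun v => by
    rw [fullConfig, fullConfig, extend_of_ne _ _ v.2.1, uncontractConfig_of_ne,
      extend_of_ne _ _ (Option.some_ne_none v)]
  simp only [h3, h4] at h1
  have := outDeg_contract_none hloop
  push_cast at h1 h2
  omega

/-- A full `head e` can burn immediately after `tail e`, so a ranking for the contraction gives one
for `G` by splitting its first vertex into `tail e` followed by `head e`. -/
lemma isRecurrent_uncontractConfig (hG : G.IsEulerian) (hloop : ¬ G.IsLoop e)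
    (hrev : G.IsReverse e e') {d : Config (none : G.ContractVertex e)}
    (hd : (G.contract e).IsRecurrent d) : G.IsRecurrent (uncontractConfig G e d) := by
  classical
  have hq : 1 ≤ G.outDeg (G.head e) := hrev.1 ▸ one_le_outDeg e'
  rw [isRecurrent_iff hG.contract, isStable_iff hG.contract] at hd
  rw [isRecurrent_iff hG, isStable_iff hG]
  obtain ⟨hst, ρ, hρ0, hρ⟩ := hd
  constructor
  · rintro ⟨v, hv⟩
    by_cases hvq : v = G.head e
    · subst hvq
      rw [uncontractConfig_head]
      exact Nat.sub_lt hq one_pos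
    · rw [uncontractConfig_of_ne d ⟨v, hv, hvq⟩]
      exact (hst _).trans_eq (outDeg_contract_some ⟨v, hv, hvq⟩)
  · let r : V → ℤ := fun v => if v = G.tail e then ρ none - 1 else ρ (G.contractMap e v)
    have hrp : r (G.tail e) = ρ none - 1 := if_pos rfl
    have hrq : r (G.head e) = ρ none := by
      simp only [r, if_neg (Ne.symm hloop), contractMap_eq_none.2 (Or.inr rfl)]
    have hr : ∀ v : {v : V // v ≠ G.tail e ∧ v ≠ G.head e}, ρ (some v) = r v := fun v => by
      simp only [r, if_neg v.2.1, contractMap_eq_some.2 rfl]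
    have hlt : ∀ v : {v : V // v ≠ G.tail e ∧ v ≠ G.head e}, ρ none < r v := fun v =>
      hr v ▸ hρ0 _ (Option.some_ne_none v)
    refine ⟨r, fun v hv => ?_, ?_⟩
    · by_cases hvq : v = G.head e
      · rw [hvq, hrp, hrq]
        omega
      · rw [hrp]
        linarith [hlt ⟨v, hv, hvq⟩]
    · rintro ⟨v, hv⟩
      by_cases hvq : v = G.head e
      · subst hvq
        rw [uncontractConfig_head]
        have h1 : lateInDeg G.numArcs r (G.head e) + G.numArcs (G.tail e) (G.head e) ≤
            ∑ u, (G.numArcs u (G.head e) : ℤ) := by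
          rw [lateInDeg, add_comm,
            ← Finset.sum_insert (f := fun u => (G.numArcs u (G.head e) : ℤ)) (by simp [hrp, hrq])]
          exact Finset.sum_le_sum_of_subset_of_nonneg (Finset.subset_univ _)
            fun _ _ _ => by positivity
        have h2 : G.numArcs (G.tail e) (G.head e) ≠ 0 := numArcs_ne_zero_iff.2 ⟨e, rfl, rfl⟩
        rw [hG.sum_numArcs_eq] at h1
        change lateInDeg G.numArcs r (G.head e) ≤ _
        omega
      · rw [uncontractConfig_of_ne d ⟨v, hv, hvq⟩]
        have := hlt ⟨v, hv, hvq⟩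
        rw [← lateInDeg_contract hloop hr (v := ⟨v, hv, hvq⟩) (by rw [hrp]; linarith)
          (by rw [hrq]; exact this) (by rw [hr]; exact this)]
        exact hρ ⟨some ⟨v, hv, hvq⟩, Option.some_ne_none _⟩

/-- Recurrent configurations of `G` in which `head e` is full come from the contraction: in a ranking,
`head e` may be moved up to `tail e`. -/
lemma exists_uncontractConfig_eq (hG : G.IsEulerian) (hloop : ¬ G.IsLoop e)
    {c : Config (G.tail e)} (hc : G.IsRecurrent c)
    (hcq : c ⟨G.head e, Ne.symm hloop⟩ + 1 = G.outDeg (G.head e)) :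
    ∃ d : Config (none : G.ContractVertex e), (G.contract e).IsRecurrent d ∧
      uncontractConfig G e d = c := by
  classical
  rw [isRecurrent_iff hG, isStable_iff hG] at hc
  obtain ⟨hst, r, hr0, hr⟩ := hc
  have hsome : ∀ x : {x : G.ContractVertex e // x ≠ none},
      ∃ v : {v : V // v ≠ G.tail e ∧ v ≠ G.head e}, x.1 = some v := fun x =>
    Option.ne_none_iff_exists'.1 x.2
  choose g hg using hsome
  have hgs : ∀ v : {v : V // v ≠ G.tail e ∧ v ≠ G.head e},
      g ⟨some v, Option.some_ne_none _⟩ = v := fun v =>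
    (Option.some_injective _ (hg ⟨some v, Option.some_ne_none _⟩)).symm
  refine ⟨fun x => c ⟨g x, (g x).2.1⟩, ?_, ?_⟩
  · rw [isRecurrent_iff hG.contract, isStable_iff hG.contract]
    constructor
    · intro x
      rw [hg x, outDeg_contract_some]
      exact hst _
    · let r' : V → ℤ := Function.update r (G.head e) (r (G.tail e))
      have hr' : ∀ v ≠ G.head e, r' v = r v := fun v hv => Function.update_of_ne hv _ _
      let ρ : G.ContractVertex e → ℤ := fun x => x.elim (r (G.tail e)) fun v => r v
      refine ⟨ρ, fun x hx => ?_, fun x => ?_⟩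
      · obtain ⟨v, rfl⟩ := Option.ne_none_iff_exists'.1 hx
        exact hr0 v v.2.1
      · have hlt := hr0 (g x) (g x).2.1
        rw [hg x, lateInDeg_contract hloop (r := r') (fun u => (hr' u u.2.2).symm)
          (by rw [hr' _ hloop, hr' _ (g x).2.2]; exact hlt)
          (by rw [hr' _ (g x).2.2]; simpa [r'] using hlt) hlt]
        refine le_trans ?_ (hr ⟨g x, (g x).2.1⟩)
        refine Finset.sum_le_sum_of_subset_of_nonneg (fun u hu => ?_) fun _ _ _ => by positivity
        simp only [Finset.mem_filter, Finset.mem_univ, true_and, hr' _ (g x).2.2] at hu ⊢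
        by_cases huq : u = G.head e
        · subst huq
          simp only [r', Function.update_self] at hu
          omega
        · rwa [hr' u huq] at hu
  · ext ⟨v, hv⟩
    by_cases hvq : v = G.head e
    · subst hvq
      rw [uncontractConfig_head]
      omega
    · rw [uncontractConfig_of_ne _ ⟨v, hv, hvq⟩]
      simp only [hgs]

omit [Fintype V] [Finite A] in
lemma uncontractConfig_injective : Function.Injective (uncontractConfig G e) := fun d d' h => by
  ext ⟨x, hx⟩
  obtain ⟨v, rfl⟩ := Option.ne_none_iff_exists'.1 hx
  rw [← uncontractConfig_of_ne d, h, uncontractConfig_of_ne]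

omit [Fintype V] [Finite A] in
lemma ncard_setOf_pair_head (hloop : ¬ G.IsLoop e) (hrev : G.IsReverse e e') :
    {a | a ∈ ({e, e'} : Set A) ∧ G.tail a = G.head e}.ncard = 1 := by
  rw [Set.ncard_eq_one]
  refine ⟨e', Set.ext fun a => ⟨?_, ?_⟩⟩
  · rintro ⟨rfl | rfl, h⟩
    · exact absurd h hloop
    · rfl
  · rintro rfl
    exact ⟨Or.inr rfl, hrev.1⟩

/-- Deleting `e` and `e'` changes no arc between vertices other than the sink `tail e`, so burnability
is unaffected, and stability becomes stricter by one chip at `head e`. -/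
lemma isRecurrent_deleteArcs_pair_iff (hG : G.IsEulerian) (hloop : ¬ G.IsLoop e)
    (hbridge : ¬ G.IsBridge e) (hrev : G.IsReverse e e') {c : Config (G.tail e)} :
    (G.deleteArcs {e, e'}).IsRecurrent c ↔
      G.IsRecurrent c ∧ c ⟨G.head e, Ne.symm hloop⟩ + 1 ≠ G.outDeg (G.head e) := by
  have hK := hG.deleteArcs_pair hbridge hrev
  have hnum : ∀ u ≠ G.tail e, ∀ v ≠ G.tail e,
      (G.deleteArcs {e, e'}).numArcs u v = G.numArcs u v := fun u hu v hv => by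
    rw [← numArcs_deleteArcs G {e, e'},
      show {a | a ∈ ({e, e'} : Set A) ∧ G.tail a = u ∧ G.head a = v} = ∅ from
        Set.eq_empty_of_forall_notMem (by
          rintro _ ⟨rfl | rfl, h1, h2⟩
          · exact hu h1.symm
          · exact hv (h2.symm.trans hrev.2)), Set.ncard_empty, add_zero]
  have hout : ∀ v ≠ G.tail e, v ≠ G.head e → (G.deleteArcs {e, e'}).outDeg v = G.outDeg v :=
    fun v hv hv' => by
      rw [← outDeg_deleteArcs G {e, e'},
        show {a | a ∈ ({e, e'} : Set A) ∧ G.tail a = v} = ∅ from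
          Set.eq_empty_of_forall_notMem (by
            rintro _ ⟨rfl | rfl, h1⟩
            · exact hv h1.symm
            · exact hv' (h1.symm.trans hrev.1)), Set.ncard_empty, add_zero]
  have hq := outDeg_deleteArcs G {e, e'} (G.head e)
  rw [ncard_setOf_pair_head hloop hrev] at hq
  rw [isRecurrent_iff hG, isRecurrent_iff hK, isBurnable_congr hnum, and_right_comm]
  refine and_congr_left fun _ => ?_
  rw [isStable_iff hG, isStable_iff hK]
  constructor
  · refine fun h => ⟨fun v => ?_, ?_⟩
    · by_cases hv : v.1 = G.head e
      · have := h v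
        rw [hv] at this ⊢
        omega
      · exact (h v).trans_eq (hout v v.2 hv)
    · have := h ⟨G.head e, Ne.symm hloop⟩
      simp only at this
      omega
  · rintro ⟨h, hne⟩ ⟨v, hv⟩
    by_cases hvq : v = G.head e
    · subst hvq
      have := h ⟨G.head e, hv⟩
      simp only at this ⊢
      omega
    · exact (h _).trans_eq (hout v hv hvq).symm

/-- Deletion-contraction before normalization, with the sink at the tail of `e`: the recurrent
configurations with `head e` full are those of the contraction, the others those of the deletion. -/
theorem recurrentSum_eq_add (hG : G.IsEulerian) (hloop : ¬ G.IsLoop e) (hbridge : ¬ G.IsBridge e)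
    (hrev : G.IsReverse e e') [Fintype (G.ContractVertex e)] :
    G.recurrentSum (G.tail e) =
      LaurentPolynomial.T 1 * (G.deleteArcs {e, e'}).recurrentSum (G.tail e) +
        (G.contract e).recurrentSum none := by
  classical
  have hfin := finite_setOf_isRecurrent (s := G.tail e) hG
  have hK := hG.deleteArcs_pair hbridge hrev
  have hq : 1 ≤ G.outDeg (G.head e) := hrev.1 ▸ one_le_outDeg e'
  have hp : (G.deleteArcs {e, e'}).outDeg (G.tail e) + 1 = G.outDeg (G.tail e) := by
    rw [← outDeg_deleteArcs G {e, e'},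
      show {a | a ∈ ({e, e'} : Set A) ∧ G.tail a = G.tail e} = {e} from Set.ext fun a => ⟨by
        rintro ⟨rfl | rfl, h⟩
        · rfl
        · exact absurd (h.symm.trans hrev.1) hloop, by
        rintro rfl
        exact ⟨Or.inl rfl, rfl⟩⟩, Set.ncard_singleton]
  have hunion : {c : Config (G.tail e) | G.IsRecurrent c} =
      {c | (G.deleteArcs {e, e'}).IsRecurrent c} ∪
        {c | G.IsRecurrent c ∧ c ⟨G.head e, Ne.symm hloop⟩ + 1 = G.outDeg (G.head e)} := by
    ext c
    simp only [Set.mem_union, Set.mem_ofPred_eq,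
      isRecurrent_deleteArcs_pair_iff hG hloop hbridge hrev]
    tauto
  rw [recurrentSum, hunion, finsum_mem_union _ (finite_setOf_isRecurrent hK)
    (hfin.subset fun c hc => hc.1)]
  · congr 1
    · rw [recurrentSum, finsum_mem_eq_finite_toFinset_sum _ (finite_setOf_isRecurrent hK),
        finsum_mem_eq_finite_toFinset_sum _ (finite_setOf_isRecurrent hK), Finset.mul_sum]
      refine Finset.sum_congr rfl fun c _ => ?_
      rw [← LaurentPolynomial.T_add, chipSum_cast, chipSum_cast, ← hp]
      congr 1
      push_cast
      ring
    · have hbij : Set.BijOn (uncontractConfig G e)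
          {d : Config (none : G.ContractVertex e) | (G.contract e).IsRecurrent d}
          {c | G.IsRecurrent c ∧ c ⟨G.head e, Ne.symm hloop⟩ + 1 = G.outDeg (G.head e)} := by
        refine ⟨fun d hd => ⟨isRecurrent_uncontractConfig hG hloop hrev hd, ?_⟩,
          uncontractConfig_injective.injOn,
          fun c hc => exists_uncontractConfig_eq hG hloop hc.1 hc.2⟩
        rw [uncontractConfig_head]
        omega
      exact (finsum_mem_eq_of_bijOn _ hbij fun d _ => by
        rw [chipSum_uncontractConfig hloop hq]).symm
  · rw [Set.disjoint_left]
    exact fun c hc hc' => ((isRecurrent_deleteArcs_pair_iff hG hloop hbridge hrev).1 hc).2 hc'.2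

end DeletionContraction

/-! ### The minimum level in the undirected case -/

section Kappa

variable {V A : Type*} [Finite V] [Finite A] {G : MultiDigraph V A} {e e' : A}

omit [Finite V] [Finite A] in
lemma setOf_coe_eq_singleton {e' : A} (h : e' ≠ e) :
    {a : {a : A // a ≠ e} | (a : A) = e'} = {⟨e', h⟩} :=
  Set.ext fun a => (Subtype.ext_iff (a1 := a) (a2 := ⟨e', h⟩)).symm

omit [Finite V] [Finite A] in
lemma isLoop_contract_reverse (hrev : G.IsReverse e e') (h : e' ≠ e) :
    (G.contract e).IsLoop ⟨e', h⟩ :=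
  (contractMap_eq_none.2 (Or.inr hrev.1)).trans (contractMap_eq_none.2 (Or.inl hrev.2)).symm

omit [Finite V] [Finite A] in
lemma IsReverse.ne (hrev : G.IsReverse e e') (hloop : ¬ G.IsLoop e) : e' ≠ e := by
  rintro rfl
  exact hloop hrev.1

lemma kappa_eq_kappa_deleteArcs_pair_add_one (hG : G.IsEulerian) (hU : G.IsUndirected)
    (hloop : ¬ G.IsLoop e) (hbridge : ¬ G.IsBridge e) (hrev : G.IsReverse e e') (s s₁ : V) :
    G.kappa s = (G.deleteArcs {e, e'}).kappa s₁ + 1 := by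
  have h1 := two_mul_kappa hG hU s
  have h2 := two_mul_kappa (hG.deleteArcs_pair hbridge hrev) (hU.deleteArcs_pair hrev) s₁
  have h3 : {a | ¬ (G.deleteArcs {e, e'}).IsLoop a}.ncard + _ = _ :=
    ncard_subtype_add_ncard {e, e'} fun a => ¬ G.IsLoop a
  have h4 : {a | a ∈ ({e, e'} : Set A) ∧ ¬ G.IsLoop a} = {e, e'} := by
    ext a
    refine ⟨fun h => h.1, fun h => ⟨h, ?_⟩⟩
    rcases h with rfl | rfl
    · exact hloop
    · exact fun h => hloop (hrev.2.symm.trans (h.symm.trans hrev.1))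
  rw [h4, Set.ncard_pair (hrev.ne hloop).symm] at h3
  omega

lemma kappa_eq_kappa_contract_add_numArcs (hG : G.IsEulerian) (hU : G.IsUndirected)
    (hloop : ¬ G.IsLoop e) (hrev : G.IsReverse e e') (s : V) (s₂ : G.ContractVertex e) :
    G.kappa s = ((G.contract e).deleteArcs {a | (a : A) = e'}).kappa s₂ +
      G.numArcs (G.tail e) (G.head e) := by
  have hl : ∀ a ∈ {a : {a : A // a ≠ e} | (a : A) = e'}, (G.contract e).IsLoop a := by
    rintro ⟨a, h⟩ rfl
    exact isLoop_contract_reverse hrev h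
  have h1 := two_mul_kappa hG hU s
  have h2 := two_mul_kappa (hG.contract.deleteArcs_of_isLoop hl)
    (hU.contract.deleteArcs_of_isLoop hl) s₂
  have h3 : {a | ¬ ((G.contract e).deleteArcs {a | (a : A) = e'}).IsLoop a}.ncard + _ = _ :=
    ncard_subtype_add_ncard {a : {a : A // a ≠ e} | (a : A) = e'} fun a => ¬ (G.contract e).IsLoop a
  have h4 : {a | ¬ (G.contract e).IsLoop a}.ncard + _ = _ :=
    ncard_subtype_add_ncard {e} fun a => ¬ (G.mapVertices (G.contractMap e)).IsLoop a
  rw [show {a | a ∈ ({e} : Set A) ∧ ¬ (G.mapVertices (G.contractMap e)).IsLoop a} = ∅ from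
    Set.eq_empty_of_forall_notMem (by rintro _ ⟨rfl, h⟩; exact h isLoop_mapVertices_self),
    Set.ncard_empty] at h4
  rw [show {a | a ∈ {a : {a : A // a ≠ e} | (a : A) = e'} ∧ ¬ (G.contract e).IsLoop a} = ∅ from
    Set.eq_empty_of_forall_notMem fun a h => h.2 (hl a h.1), Set.ncard_empty] at h3
  have h5 : {a | ¬ G.IsLoop a} = {a | ¬ (G.mapVertices (G.contractMap e)).IsLoop a} ∪
      ({a | G.tail a = G.tail e ∧ G.head a = G.head e} ∪
        {a | G.tail a = G.head e ∧ G.head a = G.tail e}) := by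
    ext a
    have hcm : (G.mapVertices (G.contractMap e)).IsLoop a ↔ G.IsLoop a ∨
        (G.tail a = G.tail e ∧ G.head a = G.head e) ∨
        (G.tail a = G.head e ∧ G.head a = G.tail e) := by
      change G.contractMap e _ = G.contractMap e _ ↔ G.tail a = G.head a ∨ _
      by_cases ht : G.tail a ≠ G.tail e ∧ G.tail a ≠ G.head e
      · have h1 := (contractMap_eq_some (v := ⟨G.tail a, ht⟩)).2 rfl
        rw [h1, eq_comm, contractMap_eq_some]
        have := ht.1
        have := ht.2
        tauto
      · have h1 : G.contractMap e (G.tail a) = none := contractMap_eq_none.2 (by tauto)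
        rw [h1, eq_comm, contractMap_eq_none]
        have ht' : G.tail a = G.tail e ∨ G.tail a = G.head e := by tauto
        rcases ht' with h | h <;> rw [h] <;> tauto
    have hne : G.tail e ≠ G.head e := hloop
    simp only [Set.mem_union, Set.mem_ofPred_eq, hcm]
    constructor
    · tauto
    · rintro (h | ⟨h, h'⟩ | ⟨h, h'⟩) hl
      · tauto
      · exact hne (h ▸ h' ▸ hl)
      · exact hne (h ▸ h' ▸ hl.symm)
  have hdisj : Disjoint {a | ¬ (G.mapVertices (G.contractMap e)).IsLoop a}
      ({a | G.tail a = G.tail e ∧ G.head a = G.head e} ∪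
        {a | G.tail a = G.head e ∧ G.head a = G.tail e}) := by
    rw [Set.disjoint_right]
    rintro a (⟨h1, h2⟩ | ⟨h1, h2⟩) h
    · exact h ((contractMap_eq_none.2 (Or.inl h1)).trans (contractMap_eq_none.2 (Or.inr h2)).symm)
    · exact h ((contractMap_eq_none.2 (Or.inr h1)).trans (contractMap_eq_none.2 (Or.inl h2)).symm)
  rw [h5, Set.ncard_union_eq hdisj, Set.ncard_union_eq] at h1
  · have h6 := hU (G.tail e) (G.head e)
    change _ = _ + (G.numArcs (G.tail e) (G.head e) + G.numArcs (G.head e) (G.tail e)) at h1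
    omega
  · rw [Set.disjoint_left]
    exact fun a h h' => hloop (h.1.symm.trans h'.1)

end Kappa

end MultiDigraph

theorem proposition8 {V A : Type*} [Finite V] [Finite A] (G : MultiDigraph V A)
    (hG : G.IsEulerian) (e e' : A) (hloop : ¬ G.IsLoop e) (hbridge : ¬ G.IsBridge e)
    (hrev : G.IsReverse e e') :
    (∀ (s s₁ : V) (s₂ : G.ContractVertex e),
      G.tutte s =
        LaurentPolynomial.T
            (1 + ((G.deleteArcs {e, e'}).kappa s₁ : ℤ) - (G.kappa s : ℤ)) *
          (G.deleteArcs {e, e'}).tutte s₁ +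
        LaurentPolynomial.T (((G.contract e).kappa s₂ : ℤ) - (G.kappa s : ℤ)) *
          (G.contract e).tutte s₂) ∧
    (G.IsUndirected → ∀ (s s₁ : V) (s₂ : G.ContractVertex e),
      G.tutte s =
        (G.deleteArcs {e, e'}).tutte s₁ +
        LaurentPolynomial.T (1 - (G.numArcs (G.tail e) (G.head e) : ℤ)) *
          ((G.contract e).deleteArcs {a | (a : A) = e'}).tutte s₂) := by
  classical
  have := Fintype.ofFinite V
  have hK := hG.deleteArcs_pair hbridge hrev
  have hmain := MultiDigraph.recurrentSum_eq_add hG hloop hbridge hrev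
  refine ⟨fun s s₁ s₂ => ?_, fun hU s s₁ s₂ => ?_⟩
  · rw [MultiDigraph.tutte_eq_T_mul_recurrentSum hG s (G.tail e),
      MultiDigraph.tutte_eq_T_mul_recurrentSum hK s₁ (G.tail e),
      MultiDigraph.tutte_eq_T_mul_recurrentSum hG.contract s₂ none, hmain, mul_add,
      ← mul_assoc, ← mul_assoc, ← mul_assoc, ← LaurentPolynomial.T_add, ← LaurentPolynomial.T_add, ← LaurentPolynomial.T_add]
    congr 3 <;> ring
  · have hne := hrev.ne hloop
    have hl := MultiDigraph.isLoop_contract_reverse hrev hne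
    have hκ := MultiDigraph.kappa_eq_kappa_contract_add_numArcs hG hU hloop hrev s s₂
    have hκ' := MultiDigraph.kappa_eq_kappa_deleteArcs_pair_add_one hG hU hloop hbridge hrev s s₁
    have hrec := MultiDigraph.recurrentSum_deleteArcs_singleton (s := none) hG.contract hl
      (MultiDigraph.contractMap_eq_none.2 (Or.inr hrev.1))
    rw [MultiDigraph.setOf_coe_eq_singleton hne] at hκ ⊢
    rw [MultiDigraph.tutte_eq_T_mul_recurrentSum hG s (G.tail e),
      MultiDigraph.tutte_eq_T_mul_recurrentSum hK s₁ (G.tail e),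
      MultiDigraph.tutte_eq_T_mul_recurrentSum
        (hG.contract.deleteArcs_of_isLoop (S := {⟨e', hne⟩}) (by rintro _ rfl; exact hl)) s₂ none,
      hmain, hrec, mul_add, ← mul_assoc, ← mul_assoc, ← mul_assoc, ← LaurentPolynomial.T_add,
      ← LaurentPolynomial.T_add]
    congr 3 <;> omega
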